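/- Let $\Bbbk$ be a commutative ring and let $\mathcal T$ be a small category with a zero object and finite coproducts, the coproduct being denoted by $*$. Write $\mathcal T\text{-}\mathbf{Mod}$ (resp. $\mathbf{Mod}\text{-}\mathcal T$) for the category of covariant (resp. contravariant) functors from $\mathcal T$ to $\Bbbk$-modules, and similarly for every small category $\mathcal C$; for $X\in\mathbf{Mod}\text{-}\mathcal C$ and $Y\in\mathcal C\text{-}\mathbf{Mod}$ let $X\otimes_{\mathcal C}Y$ be the coend of $(c,d)\mapsto X(c)\otimes_{\Bbbk}Y(d)$ and let $\mathrm{Tor}^{\mathcal C}_*(X,Y)$ be its left derived functors (with respect to either variable). A functor $F\in\mathbf{Mod}\text{-}\mathcal T$ is polynomial of degree at most $d$ if for all objects $a_0,\dots,a_d$ the intersection of the kernels of the maps $F(a_0*\cdots*a_d)\to F(a_0*\cdots*\widehat{a_i}*\cdots*a_d)$, $0\le i\le d$, induced by the canonical inclusions, is zero. It is analytic if it is a colimit of polynomial functors (of arbitrary degrees). Let $\mathbf S(\mathcal T)$ be the category with the same objects as $\mathcal T$ whose morphisms $a\to b$ are the pairs $(u:a\to b,\ v:b\to a)$ with $v\circ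 u=\mathrm{id}_a$, and let $\mathbf S_c(\mathcal T)$ be the subcategory with the same objects formed by the $(u,v)$ for which there are an object $t$ and an isomorphism $b\simeq a*t$ which carries $u$ to the canonical inclusion $a\to a*t$ and $v$ to the canonical projection $a*t\to a$. Assume (H) for every object $a$ of $\mathcal T$, the folding map $a*a\to a$ is isomorphic, as an arrow, to a canonical projection $x*y\to x$. Let $\mathcal C$ be a subcategory of $\mathbf S(\mathcal T)$ containing $\mathbf S_c(\mathcal T)$ such that (a) $\mathcal C$ is stable under translations: if $(u,v):a\to a'$ is in $\mathcal C$ and $b$ is an object of $\mathcal T$, then $(u*\mathrm{id}_b,v*\mathrm{id}_b):a*b\to a'*b$ is in $\mathcal C$; (b) for every morphism $\psi:g\to a$ of $\mathcal T$, the morphism $a\to g*a$ of $\mathbf S(\mathcal T)$ formed by the canonical inclusion $a\to g*a$ and the morphism $(\psi,\mathrm{id}_a):g*a\to a$ is in $\mathcal C$. Let $\beta:\mathcal C\to\mathcal T^{op}$ be the functor which is the identity on objects and sends $(u,v)$ to $v$. Then, for every analytic $F\in\mathbf{Mod}\text{-}\mathcal T$, every $G\in\mathcal T\text{-}\mathbf{Mod}$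 and every $n\ge 0$, the canonical map induced by $\beta$ $$\mathrm{Tor}^{\mathcal C}_n(\beta^*G,\beta^*F)\longrightarrow\mathrm{Tor}^{\mathcal T}_n(F,G)$$ is an isomorphism. Moreover, the category $\mathcal T=\mathbf{gr}$ of free groups of finite rank has a zero object and finite coproducts and satisfies (H), and $\mathcal C=\mathbf S_c(\mathbf{gr})$ satisfies (a) and (b) (so that (b) holds for every subcategory of $\mathbf S(\mathbf{gr})$ containing $\mathbf S_c(\mathbf{gr})$). -/

import Mathlib

open CategoryTheory CategoryTheory.Limits Opposite

universe u

namespace FunctorHomology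

/-! ### Enough projectives in categories of functors to modules -/

section EnoughProjectives

variable (k : Type u) [CommRing k] {C : Type u} [SmallCategory C]

/-- The functor `k[C(c, -)]`. -/
noncomputable def standardProjective (c : C) : C ⥤ ModuleCat.{u} k :=
  coyoneda.obj (op c) ⋙ ModuleCat.free k

variable {k}

/-- The morphism `k[C(c, -)] ⟶ Y` which corresponds to `y : Y c` (Yoneda lemma). -/
noncomputable def fromStandard (Y : C ⥤ ModuleCat.{u} k) (c : C) (y : Y.obj c) :
    standardProjective k c ⟶ Y where
  app d := ModuleCat.freeDesc (↾fun f : c ⟶ d => (Y.map f).hom y)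
  naturality d e g := by
    refine ModuleCat.free_hom_ext ?_
    intro f
    simp [standardProjective]

lemma fromStandard_app (Y : C ⥤ ModuleCat.{u} k) (c : C) (y : Y.obj c) :
    (fromStandard Y c y).app c (ModuleCat.freeMk (𝟙 c)) = y :=
  (ModuleCat.freeDesc_apply (↾fun f : c ⟶ c => (Y.map f).hom y) (𝟙 c)).trans (by simp)

instance standardProjective_projective (c : C) : Projective (standardProjective k c) where
  factors {E X} f e _ := by
    have h := (ModuleCat.epi_iff_surjective (e.app c)).mp inferInstance
    obtain ⟨y, hy⟩ := h (f.app c (ModuleCat.freeMk (𝟙 c)))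
    refine ⟨fromStandard E c y, ?_⟩
    refine NatTrans.ext (funext fun d => ModuleCat.free_hom_ext fun g => ?_)
    have h1 := ConcreteCategory.congr_hom (e.naturality g) y
    have h2 := ConcreteCategory.congr_hom (f.naturality g) (ModuleCat.freeMk (𝟙 c))
    have h3 : (standardProjective k c).map g (ModuleCat.freeMk (𝟙 c)) = ModuleCat.freeMk g :=
      (ModuleCat.free_map_apply ((coyoneda.obj (op c)).map g) (𝟙 c)).trans (by simp)
    have h4 : (fromStandard E c y).app d (ModuleCat.freeMk g) = E.map g y :=
      ModuleCat.freeDesc_apply (↾fun f : c ⟶ d => (E.map f).hom y) g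
    calc e.app d ((fromStandard E c y).app d (ModuleCat.freeMk g))
        = e.app d (E.map g y) := congrArg _ h4
      _ = X.map g (e.app c y) := h1
      _ = X.map g (f.app c (ModuleCat.freeMk (𝟙 c))) := congrArg _ hy
      _ = f.app d ((standardProjective k c).map g (ModuleCat.freeMk (𝟙 c))) := h2.symm
      _ = f.app d (ModuleCat.freeMk g) := congrArg _ h3

instance enoughProjectives_functor : EnoughProjectives (C ⥤ ModuleCat.{u} k) where
  presentation Y := ⟨{
    p := ∐ fun i : (Σ c : C, Y.obj c) => standardProjective k i.1
    f := Sigma.desc fun i => fromStandard Y i.1 i.2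
    epi := by
      have : ∀ c : C, Epi ((Sigma.desc fun i : (Σ c : C, Y.obj c) =>
          fromStandard Y i.1 i.2).app c) := by
        intro c
        rw [ModuleCat.epi_iff_surjective]
        intro y
        refine ⟨(Sigma.ι (fun i : (Σ c : C, Y.obj c) => standardProjective k i.1)
          ⟨c, y⟩).app c (ModuleCat.freeMk (𝟙 c)), ?_⟩
        have h : Sigma.ι (fun i : (Σ c : C, Y.obj c) => standardProjective k i.1) ⟨c, y⟩ ≫
            Sigma.desc (fun i : (Σ c : C, Y.obj c) => fromStandard Y i.1 i.2) =
              fromStandard Y c y := Sigma.ι_desc _ _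
        exact (ConcreteCategory.congr_hom (NatTrans.congr_app h c) _).trans
          (fromStandard_app Y c y)
      exact NatTrans.epi_of_epi_app _ }⟩

end EnoughProjectives

/-! ### Comparison of left derived functors along an exact functor -/

section Comparison

universe v₁ v₂ v₃ u₁ u₂ u₃

variable {A : Type u₁} [Category.{v₁} A] [Abelian A]
  {B : Type u₂} [Category.{v₂} B] [Abelian B]
  {M : Type u₃} [Category.{v₃} M] [Abelian M]

section Lift

variable (E : A ⥤ B) [E.Additive] {Z : A}
  (P : ProjectiveResolution (E.obj Z)) (Q : ProjectiveResolution Z)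

/-- The image under `E` of a projective resolution of `Z`: a complex in `B`, which is a
resolution of `E Z` as `E` is exact. -/
noncomputable abbrev mapResolution : ChainComplex B ℕ :=
  (E.mapHomologicalComplex (ComplexShape.down ℕ)).obj Q.complex

/-- The image under `E` of the augmentation of a projective resolution of `Z`. -/
noncomputable def mapAugmentation : (mapResolution E Q).X 0 ⟶ E.obj Z := E.map (Q.π.f 0)

lemma d_mapAugmentation : (mapResolution E Q).d 1 0 ≫ mapAugmentation E Q = 0 :=
  (E.map_comp _ _).symm.trans ((congrArg E.map Q.complex_d_comp_π_f_zero).trans (E.map_zero _ _))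

variable [E.PreservesHomology]

lemma mapResolution_exact₀ :
    (ShortComplex.mk ((mapResolution E Q).d 1 0) (mapAugmentation E Q)
      (d_mapAugmentation E Q)).Exact :=
  Q.exact₀.map E

instance mapAugmentation_epi : Epi (mapAugmentation E Q) := by
  have := Functor.preservesEpimorphisms_of_map_exact E fun S hS => hS.map E
  exact E.map_epi (Q.π.f 0)

lemma mapResolution_exact_succ (n : ℕ) :
    (ShortComplex.mk ((mapResolution E Q).d (n + 2) (n + 1)) ((mapResolution E Q).d (n + 1) n)
      (HomologicalComplex.d_comp_d _ _ _ _)).Exact :=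
  (Q.exact_succ n).map E

/-- Degree zero of `liftResolution`. -/
noncomputable def liftZero : P.complex.X 0 ⟶ (mapResolution E Q).X 0 :=
  Projective.factorThru (X := E.obj Z) (P.π.f 0) (mapAugmentation E Q)

lemma liftZero_comp : liftZero E P Q ≫ mapAugmentation E Q = P.π.f 0 :=
  Projective.factorThru_comp _ _

/-- Degree one of `liftResolution`. -/
noncomputable def liftOne : P.complex.X 1 ⟶ (mapResolution E Q).X 1 :=
  (mapResolution_exact₀ E Q).liftFromProjective (P.complex.d 1 0 ≫ liftZero E P Q)
    ((Category.assoc _ _ _).trans ((congrArg _ (liftZero_comp E P Q)).trans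
      P.complex_d_comp_π_f_zero))

lemma liftOne_comm :
    liftOne E P Q ≫ (mapResolution E Q).d 1 0 = P.complex.d 1 0 ≫ liftZero E P Q :=
  (mapResolution_exact₀ E Q).liftFromProjective_comp _ _

/-- The comparison morphism from a projective resolution `P` of `E Z` to the image under `E`
of a projective resolution `Q` of `Z`. It lifts the identity of `E Z`, and this determines it
up to homotopy. -/
noncomputable def liftResolution : P.complex ⟶ mapResolution E Q :=
  ChainComplex.mkHom _ _ (liftZero E P Q) (liftOne E P Q) (liftOne_comm E P Q)
    fun n ⟨_, g', w⟩ =>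
      ⟨(mapResolution_exact_succ E Q n).liftFromProjective
          (P.complex.d (n + 2) (n + 1) ≫ g') ((Category.assoc _ _ _).trans
            ((congrArg _ w).trans (by simp))),
        (mapResolution_exact_succ E Q n).liftFromProjective_comp _ _⟩

/-- `liftResolution` is compatible with the augmentations to `E Z`. -/
lemma liftResolution_comm :
    (liftResolution E P Q).f 0 ≫ mapAugmentation E Q = P.π.f 0 :=
  liftZero_comp E P Q

end Lift

/-- Let `E : A ⥤ B` be exact and let `α : E ⋙ S ⟶ S'` be a natural transformation, where `S` and
`S'` are additive functors on `B` and `A`. This is the induced map `(Lₙ S) (E Z) ⟶ (Lₙ S') Z`: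
with projective resolutions `P` of `E Z` and `Q` of `Z`, it is the map induced on `n`-th homology
by `S P ⟶ S (E Q) ⟶ S' Q`, where the first map comes from a lift `P ⟶ E Q` of the identity of
`E Z` and the second one is `α`. -/
noncomputable def derivedComparison [EnoughProjectives A] [EnoughProjectives B]
    (E : A ⥤ B) [E.Additive] [E.PreservesHomology]
    (S : B ⥤ M) [S.Additive] (S' : A ⥤ M) [S'.Additive] (α : E ⋙ S ⟶ S') (n : ℕ) (Z : A) :
    (S.leftDerived n).obj (E.obj Z) ⟶ (S'.leftDerived n).obj Z :=
  ((projectiveResolution (E.obj Z)).isoLeftDerivedObj S n).hom ≫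
    (HomologicalComplex.homologyFunctor M (ComplexShape.down ℕ) n).map
      ((S.mapHomologicalComplex _).map
          (liftResolution E (projectiveResolution (E.obj Z)) (projectiveResolution Z)) ≫
        (NatTrans.mapHomologicalComplex α _).app (projectiveResolution Z).complex) ≫
      ((projectiveResolution Z).isoLeftDerivedObj S' n).inv

end Comparison

/-! ### Tensor products and torsion groups of functors -/

section Tor

open MonoidalCategory

variable (k : Type u) [CommRing k] (C : Type u) [SmallCategory C]

/-- The tensor product over `C`, as a bifunctor: `X ⊗_C Y` is the coend of the external tensor
product `(c, d) ↦ X c ⊗ Y d`, for `X` contravariant and `Y` covariant on `C`. -/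
noncomputable def tensorOver :
    (Cᵒᵖ ⥤ ModuleCat.{u} k) ⥤ (C ⥤ ModuleCat.{u} k) ⥤ ModuleCat.{u} k :=
  externalProductBifunctorCurried Cᵒᵖ C (ModuleCat.{u} k) ⋙
    (Functor.whiskeringRight _ _ _).obj (coendFunctor C (ModuleCat.{u} k))

variable {k C}

/-- The canonical map `X c ⊗ Y c ⟶ X ⊗_C Y`. -/
noncomputable def tensorι (X : Cᵒᵖ ⥤ ModuleCat.{u} k) (Y : C ⥤ ModuleCat.{u} k) (c : C) :
    X.obj (op c) ⊗ Y.obj c ⟶ ((tensorOver k C).obj X).obj Y :=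
  coend.ι (((externalProductBifunctorCurried Cᵒᵖ C (ModuleCat.{u} k)).obj
    X).obj Y) c

lemma tensorOver_hom_ext {X : Cᵒᵖ ⥤ ModuleCat.{u} k} {Y : C ⥤ ModuleCat.{u} k}
    {N : ModuleCat.{u} k} {f g : ((tensorOver k C).obj X).obj Y ⟶ N}
    (h : ∀ c, tensorι X Y c ≫ f = tensorι X Y c ≫ g) : f = g :=
  coend.hom_ext h

lemma tensorι_condition (X : Cᵒᵖ ⥤ ModuleCat.{u} k) (Y : C ⥤ ModuleCat.{u} k) {c d : C}
    (f : c ⟶ d) :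
    X.map f.op ▷ Y.obj c ≫ tensorι X Y c =
      X.obj (op d) ◁ Y.map f ≫ tensorι X Y d := by
  have h := coend.condition
    (((externalProductBifunctorCurried Cᵒᵖ C (ModuleCat.{u} k)).obj X).obj Y) f
  simp only [externalProductBifunctorCurried_obj_obj_map_app,
    externalProductBifunctorCurried_obj_obj_obj_map] at h
  exact h

/-- The universal property of `X ⊗_C Y`. -/
noncomputable def tensorDesc (X : Cᵒᵖ ⥤ ModuleCat.{u} k) (Y : C ⥤ ModuleCat.{u} k)
    {N : ModuleCat.{u} k} (φ : ∀ c, X.obj (op c) ⊗ Y.obj c ⟶ N)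
    (hφ : ∀ ⦃c d : C⦄ (f : c ⟶ d),
      (X.map f.op ▷ Y.obj c) ≫ φ c = (X.obj (op d) ◁ Y.map f) ≫ φ d) :
    ((tensorOver k C).obj X).obj Y ⟶ N :=
  coend.desc (F := ((externalProductBifunctorCurried Cᵒᵖ C (ModuleCat.{u} k)).obj X).obj Y) φ
    (fun c d f => by
      simpa only [externalProductBifunctorCurried_obj_obj_map_app,
        externalProductBifunctorCurried_obj_obj_obj_map] using hφ f)

lemma ι_tensorDesc (X : Cᵒᵖ ⥤ ModuleCat.{u} k) (Y : C ⥤ ModuleCat.{u} k)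
    {N : ModuleCat.{u} k} (φ : ∀ c, X.obj (op c) ⊗ Y.obj c ⟶ N)
    (hφ : ∀ ⦃c d : C⦄ (f : c ⟶ d),
      (X.map f.op ▷ Y.obj c) ≫ φ c = (X.obj (op d) ◁ Y.map f) ≫ φ d) (c : C) :
    tensorι X Y c ≫ tensorDesc X Y φ hφ = φ c :=
  coend.ι_desc (F := ((externalProductBifunctorCurried Cᵒᵖ C (ModuleCat.{u} k)).obj X).obj Y) _ _ c

lemma tensorι_map_right (X : Cᵒᵖ ⥤ ModuleCat.{u} k) {Y Y' : C ⥤ ModuleCat.{u} k} (f : Y ⟶ Y')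
    (c : C) :
    tensorι X Y c ≫ ((tensorOver k C).obj X).map f =
      X.obj (op c) ◁ f.app c ≫ tensorι X Y' c := by
  have h := coend.ι_map
    (((externalProductBifunctorCurried Cᵒᵖ C (ModuleCat.{u} k)).obj X).map f) c
  rw [externalProductBifunctorCurried_obj_map_app_app] at h
  exact h

lemma tensorι_map_left {X X' : Cᵒᵖ ⥤ ModuleCat.{u} k} (f : X ⟶ X') (Y : C ⥤ ModuleCat.{u} k)
    (c : C) :
    tensorι X Y c ≫ ((tensorOver k C).map f).app Y =
      f.app (op c) ▷ Y.obj c ≫ tensorι X' Y c := by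
  have h := coend.ι_map
    (((externalProductBifunctorCurried Cᵒᵖ C (ModuleCat.{u} k)).map f).app Y) c
  rw [externalProductBifunctorCurried_map_app_app_app] at h
  exact h

instance tensorOver_obj_additive (X : Cᵒᵖ ⥤ ModuleCat.{u} k) :
    ((tensorOver k C).obj X).Additive where
  map_add {Y Z f g} := tensorOver_hom_ext fun c => by
    simp only [tensorι_map_right, Preadditive.comp_add, NatTrans.app_add,
      MonoidalPreadditive.whiskerLeft_add, Preadditive.add_comp]

instance tensorOver_flip_obj_additive (Y : C ⥤ ModuleCat.{u} k) :
    ((tensorOver k C).flip.obj Y).Additive where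
  map_add {X Z f g} := tensorOver_hom_ext fun c => by
    simp only [Functor.flip_obj_map, tensorι_map_left, Preadditive.comp_add, NatTrans.app_add,
      MonoidalPreadditive.add_whiskerRight, Preadditive.add_comp]

/-- `Tor_n^C(X, Y)`, as the value at `Y` of the `n`-th left derived functor of `X ⊗_C -`. -/
noncomputable def torCov (X : Cᵒᵖ ⥤ ModuleCat.{u} k) (Y : C ⥤ ModuleCat.{u} k) (n : ℕ) :
    ModuleCat.{u} k :=
  (((tensorOver k C).obj X).leftDerived n).obj Y

/-- `Tor_n^C(X, Y)`, as the value at `X` of the `n`-th left derived functor of `- ⊗_C Y`. -/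
noncomputable def torContra (X : Cᵒᵖ ⥤ ModuleCat.{u} k) (Y : C ⥤ ModuleCat.{u} k) (n : ℕ) :
    ModuleCat.{u} k :=
  (((tensorOver k C).flip.obj Y).leftDerived n).obj X

/-- Precomposition with a functor, on functors to modules. -/
abbrev pullback (k : Type u) [CommRing k] {C D : Type u} [SmallCategory C] [SmallCategory D]
    (φ : C ⥤ D) :
    (D ⥤ ModuleCat.{u} k) ⥤ (C ⥤ ModuleCat.{u} k) :=
  (Functor.whiskeringLeft C D (ModuleCat.{u} k)).obj φ

instance pullback_additive {D : Type u} [SmallCategory D] (φ : C ⥤ D) :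
    (pullback k φ).Additive where

instance pullback_preservesHomology {D : Type u} [SmallCategory D] (φ : C ⥤ D) :
    (pullback k φ).PreservesHomology := by
  have : PreservesFiniteLimits (pullback k φ) := ⟨fun _ => inferInstance⟩
  have : PreservesFiniteColimits (pullback k φ) := ⟨fun _ => inferInstance⟩
  infer_instance

variable {T : Type u} [SmallCategory T] (β : C ⥤ Tᵒᵖ)

/-- Let `β : C ⥤ Tᵒᵖ`. For `G` covariant and `F` contravariant on `T`, this is the canonical map
`β^*G ⊗_C β^*F ⟶ F ⊗_T G` which sends the class of `x ⊗ y`, with `x ⊗ y` in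
`G (β c) ⊗ F (β c)`, to the class of `y ⊗ x`. -/
noncomputable def tensorComparisonApp (G : T ⥤ ModuleCat.{u} k) (F : Tᵒᵖ ⥤ ModuleCat.{u} k) :
    ((tensorOver k C).obj (β.leftOp ⋙ G)).obj (β ⋙ F) ⟶ ((tensorOver k T).obj F).obj G :=
  tensorDesc (β.leftOp ⋙ G) (β ⋙ F)
    (fun c => (β_ (G.obj (β.obj c).unop) (F.obj (β.obj c))).hom ≫ tensorι F G (β.obj c).unop)
    (fun c d g => by
      have h := tensorι_condition F G (β.map g).unop
      simp at h ⊢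
      rw [h])

lemma ι_tensorComparisonApp (G : T ⥤ ModuleCat.{u} k) (F : Tᵒᵖ ⥤ ModuleCat.{u} k) (c : C) :
    tensorι (β.leftOp ⋙ G) (β ⋙ F) c ≫ tensorComparisonApp β G F =
      (β_ (G.obj (β.obj c).unop) (F.obj (β.obj c))).hom ≫ tensorι F G (β.obj c).unop :=
  ι_tensorDesc _ _ _ _ c

/-- `tensorComparisonApp` as a natural transformation between functors of `F`. -/
noncomputable def tensorComparison (G : T ⥤ ModuleCat.{u} k) :
    pullback k β ⋙ (tensorOver k C).obj (β.leftOp ⋙ G) ⟶ (tensorOver k T).flip.obj G where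
  app F := tensorComparisonApp β G F
  naturality F F' f := tensorOver_hom_ext fun c => by
    have h1 := tensorι_map_right (β.leftOp ⋙ G) ((pullback k β).map f) c
    have h2 := tensorι_map_left f G (β.obj c).unop
    have h3 := ι_tensorComparisonApp β G F c
    calc tensorι (β.leftOp ⋙ G) (β ⋙ F) c ≫
          ((tensorOver k C).obj (β.leftOp ⋙ G)).map ((pullback k β).map f) ≫
            tensorComparisonApp β G F'
        = (G.obj (β.obj c).unop ◁ f.app (β.obj c)) ≫ tensorι (β.leftOp ⋙ G) (β ⋙ F') c ≫
            tensorComparisonApp β G F' := (reassoc_of% h1) _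
      _ = (G.obj (β.obj c).unop ◁ f.app (β.obj c)) ≫
            (β_ (G.obj (β.obj c).unop) (F'.obj (β.obj c))).hom ≫ tensorι F' G (β.obj c).unop :=
          congrArg _ (ι_tensorComparisonApp β G F' c)
      _ = (β_ (G.obj (β.obj c).unop) (F.obj (β.obj c))).hom ≫
            (f.app (β.obj c) ▷ G.obj (β.obj c).unop) ≫ tensorι F' G (β.obj c).unop := by
          rw [BraidedCategory.braiding_naturality_right_assoc]
      _ = (β_ (G.obj (β.obj c).unop) (F.obj (β.obj c))).hom ≫ tensorι F G (β.obj c).unop ≫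
            ((tensorOver k T).map f).app G := congrArg _ h2.symm
      _ = tensorι (β.leftOp ⋙ G) (β ⋙ F) c ≫ tensorComparisonApp β G F ≫
            ((tensorOver k T).map f).app G := by
          rw [reassoc_of% h3]

/-- The canonical map `Tor_n^C(β^*G, β^*F) ⟶ Tor_n^T(F, G)` induced by `β : C ⥤ Tᵒᵖ`, for `F`
contravariant and `G` covariant on `T`. -/
noncomputable def torComparison (F : Tᵒᵖ ⥤ ModuleCat.{u} k) (G : T ⥤ ModuleCat.{u} k) (n : ℕ) :
    torCov (β.leftOp ⋙ G) (β ⋙ F) n ⟶ torContra F G n :=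
  derivedComparison (pullback k β) ((tensorOver k C).obj (β.leftOp ⋙ G))
    ((tensorOver k T).flip.obj G) (tensorComparison β G) n F

end Tor

/-! ### Polynomial and analytic contravariant functors -/

section Polynomial

variable {k : Type u} [CommRing k] {T : Type u} [SmallCategory T] [HasFiniteCoproducts T]

/-- A contravariant functor `F` is polynomial of degree at most `d` if its cross effect of order
`d + 1` vanishes, that is if for all objects `a_0, …, a_d` the intersection of the kernels of the
`d + 1` maps `F (a_0 * ⋯ * a_d) ⟶ F (a_0 * ⋯ * â_i * ⋯ * a_d)`, induced by the canonical
inclusions, is zero. -/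
def IsPolynomialOfDegreeLE (F : Tᵒᵖ ⥤ ModuleCat.{u} k) (d : ℕ) : Prop :=
  ∀ (a : Fin (d + 1) → T) (x : F.obj (op (∐ a))),
    (∀ i : Fin (d + 1),
      F.map (Sigma.desc (fun j : {j : Fin (d + 1) // j ≠ i} => Sigma.ι a j.1)).op x = 0) →
    x = 0

/-- A functor is analytic if it is a colimit of polynomial functors. -/
def IsAnalytic (F : Tᵒᵖ ⥤ ModuleCat.{u} k) : Prop :=
  ∃ (J : Type u) (_ : SmallCategory J) (D : J ⥤ Tᵒᵖ ⥤ ModuleCat.{u} k)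
    (ι : D ⟶ (Functor.const J).obj F),
    (∀ j : J, ∃ d : ℕ, IsPolynomialOfDegreeLE (D.obj j) d) ∧ Nonempty (IsColimit (Cocone.mk F ι))

end Polynomial

/-! ### The category `S(T)` and its subcategories -/

/-- The category `S(T)`: it has the same objects as `T`, and a morphism `a ⟶ b` is a pair
`(i : a ⟶ b, r : b ⟶ a)` of morphisms of `T` such that `i ≫ r = 𝟙 a`. -/
structure SCat (T : Type u) where
  /-- The underlying object of `T`. -/
  obj : T

section SCat

variable {T : Type u} [SmallCategory T]

instance : SmallCategory (SCat T) where
  Hom a b := Retract a.obj b.obj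
  id a := Retract.refl a.obj
  comp f g := Retract.trans f g
  id_comp _ := by simp [Retract.trans, Retract.refl]
  comp_id _ := by simp [Retract.trans, Retract.refl]
  assoc _ _ _ := by simp [Retract.trans]

namespace SCat

/-- The inclusion part of a morphism of `S(T)`. -/
abbrev i {a b : SCat T} (f : a ⟶ b) : a.obj ⟶ b.obj := Retract.i f

/-- The retraction part of a morphism of `S(T)`. -/
abbrev r {a b : SCat T} (f : a ⟶ b) : b.obj ⟶ a.obj := Retract.r f

/-- The canonical functor `S(T) ⥤ Tᵒᵖ`, which sends `(i, r)` to `r`. -/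
def toOp (T : Type u) [SmallCategory T] : SCat T ⥤ Tᵒᵖ where
  obj a := op a.obj
  map f := (r f).op
  map_id _ := rfl
  map_comp _ _ := rfl

variable [HasFiniteCoproducts T]

/-- The morphism `f * b` of `S(T)`, for `f` a morphism of `S(T)` and `b` an object of `T`. -/
noncomputable def translate {a a' : SCat T} (f : a ⟶ a') (b : T) :
    SCat.mk (a.obj ⨿ b) ⟶ SCat.mk (a'.obj ⨿ b) where
  i := coprod.map (i f) (𝟙 b)
  r := coprod.map (r f) (𝟙 b)
  retract := by simp [Retract.retract f]

/-- The morphism `a ⟶ g * a` of `S(T)` given by a morphism `ψ : g ⟶ a` of `T`: its inclusion part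
is the canonical inclusion and its retraction part has the components `ψ` and `𝟙 a`. -/
noncomputable def graph {g a : T} (ψ : g ⟶ a) : SCat.mk a ⟶ SCat.mk (g ⨿ a) where
  i := coprod.inr
  r := coprod.desc ψ (𝟙 a)
  retract := coprod.inr_desc _ _

variable (T) [HasZeroMorphisms T]

/-- The subcategory `S_c(T)` of `S(T)`: same objects, and those morphisms `(i, r) : a ⟶ b` which
are isomorphic under `a` and over `a` to the inclusion `a ⟶ a * t` and the projection `a * t ⟶ a`
for some object `t`. -/
def canonical : MorphismProperty (SCat T) := fun a b f =>
  ∃ (t : T) (e : b.obj ≅ a.obj ⨿ t),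
    i f ≫ e.hom = coprod.inl ∧ e.hom ≫ coprod.desc (𝟙 a.obj) 0 = r f

variable {T} in
lemma map_associator_desc {a b t : T} (e : b ⟶ a ⨿ t) (t' : T) :
    coprod.map e (𝟙 t') ≫ (coprod.associator a t t').hom ≫ coprod.desc (𝟙 a) 0 =
      coprod.desc (𝟙 b) 0 ≫ e ≫ coprod.desc (𝟙 a) 0 := by
  have h : coprod.inl ≫ (coprod.associator a t t').hom ≫ coprod.desc (𝟙 a) 0 =
      coprod.desc (𝟙 a) 0 := by
    refine coprod.hom_ext ?_ ?_ <;>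
      simp only [coprod.associator_hom, coprod.inl_desc_assoc, coprod.inr_desc_assoc,
        coprod.inl_desc, coprod.inr_desc, Category.assoc, comp_zero]
  refine coprod.hom_ext ?_ ?_
  · rw [coprod.inl_map_assoc, h, coprod.inl_desc_assoc, Category.id_comp]
  · simp only [coprod.inr_map_assoc, coprod.associator_hom, coprod.inr_desc_assoc,
      coprod.inr_desc, Category.assoc, comp_zero, zero_comp]

instance canonical_isMultiplicative : (canonical T).IsMultiplicative where
  id_mem a := by
    obtain ⟨x⟩ := a
    let e : x ≅ x ⨿ (⊥_ T) :=
      ⟨coprod.inl, coprod.desc (𝟙 x) 0, coprod.inl_desc _ _,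
        coprod.hom_ext (by rw [coprod.inl_desc_assoc, Category.id_comp, Category.comp_id])
          (initial.hom_ext _ _)⟩
    exact ⟨⊥_ T, e, Category.id_comp _, coprod.inl_desc _ _⟩
  comp_mem {a b c} f g := by
    obtain ⟨a⟩ := a
    obtain ⟨b⟩ := b
    obtain ⟨c⟩ := c
    obtain ⟨i, r, _⟩ := f
    obtain ⟨i', r', _⟩ := g
    rintro ⟨t, e, he1, he2⟩ ⟨t', e', he1', he2'⟩
    change i ≫ e.hom = coprod.inl at he1
    change i' ≫ e'.hom = coprod.inl at he1'
    change e.hom ≫ coprod.desc (𝟙 a) 0 = r at he2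
    change e'.hom ≫ coprod.desc (𝟙 b) 0 = r' at he2'
    refine ⟨t ⨿ t', e' ≪≫ coprod.mapIso e (Iso.refl t') ≪≫ coprod.associator _ _ _, ?_, ?_⟩
    · change (i ≫ i') ≫ e'.hom ≫ coprod.map e.hom (𝟙 t') ≫ (coprod.associator a t t').hom = _
      rw [Category.assoc, reassoc_of% he1', coprod.inl_map_assoc, reassoc_of% he1]
      simp only [coprod.associator_hom, coprod.inl_desc]
    · change (e'.hom ≫ coprod.map e.hom (𝟙 t') ≫ (coprod.associator a t t').hom) ≫
        coprod.desc (𝟙 a) 0 = r' ≫ r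
      rw [← he2', ← he2, Category.assoc, Category.assoc, Category.assoc]
      exact congrArg (e'.hom ≫ ·) (map_associator_desc e.hom t')

variable {T}

/-- The conditions on a subcategory of `S(T)` with the same objects as `S(T)` that it be stable
under the translations `- * b`, and that it contain the morphisms `graph ψ`. -/
structure IsStable (W : MorphismProperty (SCat T)) : Prop where
  translate : ∀ {a a' : SCat T} (f : a ⟶ a') (b : T), W f → W (SCat.translate f b)
  graph : ∀ {g a : T} (ψ : g ⟶ a), W (SCat.graph ψ)

end SCat

variable [HasFiniteCoproducts T] [HasZeroMorphisms T]

/-- The class `E_c(T)` of the morphisms of `T` which are isomorphic to a projection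
`a * b ⟶ a`. -/
def IsCanonicalEpi {x y : T} (f : x ⟶ y) : Prop :=
  ∃ a b : T, Nonempty (Arrow.mk f ≅ Arrow.mk (coprod.desc (𝟙 a) (0 : b ⟶ a)))

variable (T) in
/-- The property (H): for every object `a`, the folding map `a * a ⟶ a` belongs to `E_c(T)`. -/
def PropertyH : Prop :=
  ∀ a : T, IsCanonicalEpi (coprod.desc (𝟙 a) (𝟙 a))

/-- The restriction of the canonical functor `S(T) ⥤ Tᵒᵖ` to a subcategory of `S(T)`. -/
def restrictedToOp (W : MorphismProperty (SCat T)) [W.IsMultiplicative] :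
    WideSubcategory W ⥤ Tᵒᵖ :=
  wideSubcategoryInclusion W ⋙ SCat.toOp T

end SCat

/-! ### Free groups of finite rank -/

/-- The category `gr`: its objects are the free groups on `n` generators, for `n : ℕ`, and its
morphisms are all the group morphisms. -/
structure Gr : Type u where
  /-- The rank. -/
  rank : ℕ

/-- The free group of a given rank. -/
def Gr.toGrp (x : Gr.{u}) : GrpCat.{u} := GrpCat.of (FreeGroup (ULift.{u} (Fin x.rank)))

instance : SmallCategory Gr.{u} := inferInstanceAs (Category (InducedCategory GrpCat.{u} Gr.toGrp))

end FunctorHomology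

/-! Write $L$ for the left Kan extension along $\beta$, left adjoint to the exact functor $\beta^*$.
By uniqueness of representing objects, $\beta^*G\otimes_{\mathcal C}X\simeq L X\otimes_{\mathcal
T}G$ (`isIso_tensorLan`), and $L$ preserves projectives. So if $P$ is a projective resolution of
$\beta^*F$ and $LP$ is a resolution of $F$, then $LP$ is a projective resolution that computes the
right-hand side, and the comparison map is an isomorphism (`isIso_derivedComparison`).

Everything thus rests on the exactness of $LP\to F$. Its value at $a$ is the colimit of $P$ over the
category `Fiber W a` of arrows $f:a\to c$, on which $P$ stays a projective resolution. What is
needed is that the homology of this category with coefficients in $f\mapsto F(c)$ is $F(a)$, in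
degree zero.

For a functor $X$ on the fiber, $\mathcal C$ contains enough morphisms to map $X(f)$ to $X(a\to
a*c^{*n})$ naturally: every extension $\rho:a*c^{*m}\to c$ of $f$ gives one by condition (b), and
one takes alternating sums over the $\rho$ whose restriction to each copy of $c$ is $0$ or the
identity. The resulting transformation `reduced` induces the identity on colimits, since all
alternating sums cancel there except the one of order zero (`reduced_comp_ι`). On the restriction of
$F$, it is the map which factors through $F(f):F(c)\to F(a)$, minus an $n$-th deviation
(`Fiber.reducedApp_apply`). Deviations of a polynomial functor vanish beyond its degree, so on an
analytic $F$ each element has only finitely many nonzero ones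
(`IsAnalytic.eventually_deviation_eq_zero`).

Hence `reduced` and a map through the value at $\mathrm{id}_a$ lift, to $P$, two maps that agree on
each element for large $n$. This bound depends on the element, so the sequences are replaced by
their germs at infinity, an exact construction: there the difference lifts zero and is
null-homotopic. On colimits, every cycle is therefore homologous to one coming from the value at
$\mathrm{id}_a$, where exactness is known (`isResolution_colim`).

For free groups, $g*a$ is identified with $a*g$ by the shear $x\mapsto\psi(x)x$ on the generators of
$g$. It turns $(\psi,\mathrm{id})$ into the canonical projection, whence (b), and also (H) with
$\psi=\mathrm{id}$. -/

namespace FunctorHomology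

/-! ### Resolutions as augmented complexes, and the comparison theorem for them. -/

section Resolutions

universe v₁ v₂ u₁ u₂

variable {A : Type u₁} [Category.{v₁} A] [Abelian A] {B : Type u₂} [Category.{v₂} B] [Abelian B]

/-- The complex `K`, augmented by `ε : K.X 0 ⟶ Z`, is a resolution of `Z`. -/
structure IsResolution (K : ChainComplex A ℕ) {Z : A} (ε : K.X 0 ⟶ Z) : Prop where
  epi : Epi ε
  d_comp : K.d 1 0 ≫ ε = 0
  exact₀ : (ShortComplex.mk (K.d 1 0) ε d_comp).Exact
  exact_succ : ∀ n, (ShortComplex.mk (K.d (n + 2) (n + 1)) (K.d (n + 1) n)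
    (K.d_comp_d _ _ _)).Exact

lemma isResolution_of_projectiveResolution {Z : A} (P : ProjectiveResolution Z) :
    IsResolution P.complex (P.π.f 0) where
  epi := inferInstance
  d_comp := P.complex_d_comp_π_f_zero
  exact₀ := P.exact₀
  exact_succ := P.exact_succ

/-- Evaluation is exact, so the homology of a complex of functors is computed objectwise. -/
lemma exact_of_evaluation {C : Type u₂} [Category.{v₂} C] {S : ShortComplex (C ⥤ A)}
    (hS : ∀ c, (S.map ((evaluation C A).obj c)).Exact) : S.Exact := by
  rw [ShortComplex.exact_iff_isZero_homology, Functor.isZero_iff]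
  intro c
  exact ((ShortComplex.exact_iff_isZero_homology _).1 (hS c)).of_iso
    (S.mapHomologyIso ((evaluation C A).obj c)).symm

namespace IsResolution

lemma map (E : A ⥤ B) [E.Additive] [E.PreservesHomology] {K : ChainComplex A ℕ} {Z : A}
    {ε : K.X 0 ⟶ Z} (h : IsResolution K ε) :
    IsResolution ((E.mapHomologicalComplex (ComplexShape.down ℕ)).obj K) (E.map ε) where
  epi := by
    have := h.epi
    have := Functor.preservesEpimorphisms_of_map_exact E fun S hS => hS.map E
    exact E.map_epi ε
  d_comp := (E.map_comp _ _).symm.trans ((congrArg E.map h.d_comp).trans (E.map_zero _ _))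
  exact₀ := h.exact₀.map E
  exact_succ n := (h.exact_succ n).map E

/-- A resolution by projective objects, as a `ProjectiveResolution`. -/
noncomputable def projectiveResolution {K : ChainComplex A ℕ} {Z : A} {ε : K.X 0 ⟶ Z}
    (h : IsResolution K ε) (hK : ∀ n, Projective (K.X n)) : ProjectiveResolution Z where
  complex := K
  projective := hK
  π := (ChainComplex.toSingle₀Equiv _ _).symm ⟨ε, h.d_comp⟩
  quasiIso := ⟨fun n => by
    cases n with
    | zero =>
      rw [ChainComplex.quasiIsoAt₀_iff, ShortComplex.quasiIso_iff_of_zeros']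
      · refine (ShortComplex.exact_and_epi_g_iff_of_iso ?_).2 ⟨h.exact₀, h.epi⟩
        refine ShortComplex.isoMk (Iso.refl _) (Iso.refl _) (Iso.refl _)
          ((Category.id_comp _).trans (Category.comp_id _).symm) ?_
        have hπ : ((ChainComplex.toSingle₀Equiv K Z).symm ⟨ε, h.d_comp⟩).f 0 = ε := by simp
        exact (Category.id_comp _).trans (hπ.symm.trans (Category.comp_id _).symm)
      · exact K.shape 0 0 (by simp)
      all_goals rfl
    | succ n =>
      rw [quasiIsoAt_iff_exactAt']
      · rw [HomologicalComplex.exactAt_iff' _ (n + 1 + 1) (n + 1) n (by simp) (by simp)]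
        exact h.exact_succ n
      · apply ChainComplex.exactAt_succ_single_obj⟩

lemma projectiveResolution_π_f_zero {K : ChainComplex A ℕ} {Z : A} {ε : K.X 0 ⟶ Z}
    (h : IsResolution K ε) (hK : ∀ n, Projective (K.X n)) :
    (h.projectiveResolution hK).π.f 0 = ε := by
  simp [projectiveResolution]

/-- A complex of functors is a resolution if all its evaluations are. -/
lemma of_evaluation {C : Type u₂} [Category.{v₂} C] {K : ChainComplex (C ⥤ A) ℕ} {Z : C ⥤ A}
    {ε : K.X 0 ⟶ Z}
    (h : ∀ c, IsResolution ((((evaluation C A).obj c).mapHomologicalComplex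
      (ComplexShape.down ℕ)).obj K) (Z := Z.obj c) (ε.app c)) :
    IsResolution K ε := by
  have hd : K.d 1 0 ≫ ε = 0 := NatTrans.ext (funext fun c => (h c).d_comp)
  refine ⟨?_, hd, exact_of_evaluation fun c => (h c).exact₀,
    fun n => exact_of_evaluation fun c => (h c).exact_succ n⟩
  have : ∀ c, Epi (ε.app c) := fun c => (h c).epi
  exact NatTrans.epi_of_epi_app _

lemma of_iso {K L : ChainComplex A ℕ} {Z : A} {ε : K.X 0 ⟶ Z} (h : IsResolution K ε)
    (e : K ≅ L) {ε' : L.X 0 ⟶ Z} (hε : e.hom.f 0 ≫ ε' = ε) : IsResolution L ε' := by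
  have hε' : ε' = e.inv.f 0 ≫ ε := by
    rw [← hε, ← Category.assoc, ← HomologicalComplex.comp_f, e.inv_hom_id,
      HomologicalComplex.id_f, Category.id_comp]
  have hd : L.d 1 0 ≫ ε' = 0 := by
    rw [hε', ← Category.assoc, ← HomologicalComplex.Hom.comm, Category.assoc, h.d_comp, comp_zero]
  let i (n : ℕ) : K.X n ≅ L.X n := (HomologicalComplex.eval A _ n).mapIso e
  refine ⟨?_, hd, ?_, fun n => ?_⟩
  · have := h.epi
    have : Epi (e.inv.f 0) := inferInstanceAs (Epi (i 0).inv)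
    rw [hε']
    exact epi_comp _ _
  · exact ShortComplex.exact_of_iso (ShortComplex.isoMk (i 1) (i 0) (Iso.refl Z)
      (e.hom.comm 1 0) (by simpa [i] using hε)) h.exact₀
  · exact ShortComplex.exact_of_iso (ShortComplex.isoMk (i (n + 2)) (i (n + 1)) (i n)
      (e.hom.comm _ _) (e.hom.comm _ _)) (h.exact_succ n)

variable {K L : ChainComplex A ℕ} {Y Z : A} {ε : L.X 0 ⟶ Z}

/-- A morphism from the target of an augmentation of a complex of projective objects lifts to
a resolution. -/
lemma exists_lift (h : IsResolution L ε) [∀ n, Projective (K.X n)] (η : K.X 0 ⟶ Y)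
    (hη : K.d 1 0 ≫ η = 0) (f : Y ⟶ Z) : ∃ g : K ⟶ L, g.f 0 ≫ ε = η ≫ f := by
  have := h.epi
  let g₀ : K.X 0 ⟶ L.X 0 := Projective.factorThru (η ≫ f) ε
  have hg₀ : g₀ ≫ ε = η ≫ f := Projective.factorThru_comp _ _
  have h₁ : (K.d 1 0 ≫ g₀) ≫ ε = 0 := by
    rw [Category.assoc, hg₀, reassoc_of% hη, zero_comp]
  refine ⟨ChainComplex.mkHom _ _ g₀ (h.exact₀.liftFromProjective (K.d 1 0 ≫ g₀) h₁)
    (h.exact₀.liftFromProjective_comp _ _) fun n ⟨_, g', w⟩ =>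
      ⟨(h.exact_succ n).liftFromProjective (K.d (n + 2) (n + 1) ≫ g')
        ((Category.assoc _ _ _).trans ((congrArg _ w).trans (by simp))),
        (h.exact_succ n).liftFromProjective_comp _ _⟩, hg₀⟩

/-- A lift of zero to a resolution is homotopic to zero. -/
lemma nonempty_homotopy (h : IsResolution L ε) [∀ n, Projective (K.X n)] (g : K ⟶ L)
    (hg : g.f 0 ≫ ε = 0) : Nonempty (Homotopy g 0) := by
  let h₀ : K.X 0 ⟶ L.X 1 := h.exact₀.liftFromProjective (g.f 0) hg
  have e₀ : h₀ ≫ L.d 1 0 = g.f 0 := h.exact₀.liftFromProjective_comp _ _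
  let h₁ : K.X 1 ⟶ L.X 2 := (h.exact_succ 0).liftFromProjective (g.f 1 - K.d 1 0 ≫ h₀)
    (by simp [Preadditive.sub_comp, e₀])
  have e₁ : h₁ ≫ L.d 2 1 = g.f 1 - K.d 1 0 ≫ h₀ := (h.exact_succ 0).liftFromProjective_comp _ _
  refine ⟨Homotopy.mkInductive _ h₀ e₀.symm h₁ (by rw [e₁]; abel) fun n ⟨a, b, w⟩ => ?_⟩
  have hw : (g.f (n + 2) - K.d (n + 2) (n + 1) ≫ b) ≫ L.d (n + 2) (n + 1) = 0 := by simp [w]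
  refine ⟨(h.exact_succ (n + 1)).liftFromProjective _ hw, ?_⟩
  have e₂ : (h.exact_succ (n + 1)).liftFromProjective _ hw ≫ L.d (n + 3) (n + 2) = _ :=
    (h.exact_succ (n + 1)).liftFromProjective_comp _ hw
  rw [e₂]
  abel

end IsResolution

end Resolutions

/-! ### Germs at infinity of sequences. -/

section Germs

variable {k : Type u} [CommRing k]

/-- The sequences which vanish eventually. -/
def eventuallyZero (M : ℕ → ModuleCat.{u} k) : Submodule k (∀ n, M n) where
  carrier := {x | ∀ᶠ n in Filter.atTop, x n = 0}
  add_mem' hx hy := by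
    filter_upwards [hx, hy] with n h₁ h₂
    simp [h₁, h₂]
  zero_mem' := Filter.Eventually.of_forall fun _ => rfl
  smul_mem' c x hx := by
    filter_upwards [hx] with n h
    simp [h]

/-- The module of germs at infinity of sequences in a sequence of modules. -/
def germ (M : ℕ → ModuleCat.{u} k) : ModuleCat.{u} k :=
  ModuleCat.of k ((∀ n, M n) ⧸ eventuallyZero M)

/-- The germ of a sequence. -/
def germMk (M : ℕ → ModuleCat.{u} k) : ModuleCat.of k (∀ n, M n) ⟶ germ M :=
  ModuleCat.ofHom (eventuallyZero M).mkQ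

lemma germMk_surjective {M : ℕ → ModuleCat.{u} k} (y : germ M) :
    ∃ x : ∀ n, M n, germMk M x = y :=
  Submodule.mkQ_surjective _ y

lemma germMk_eq_zero {M : ℕ → ModuleCat.{u} k} (x : ∀ n, M n) :
    germMk M x = 0 ↔ ∀ᶠ n in Filter.atTop, x n = 0 :=
  Submodule.Quotient.mk_eq_zero (eventuallyZero M)

lemma germMk_eq_of_eventually {M : ℕ → ModuleCat.{u} k} {x y : ∀ n, M n}
    (h : ∀ᶠ n in Filter.atTop, x n = y n) : germMk M x = germMk M y := by
  rw [← sub_eq_zero, ← map_sub, germMk_eq_zero]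
  filter_upwards [h] with n hn
  rw [Pi.sub_apply, hn, sub_self]

/-- The map on products induced by a sequence of maps. -/
def piMap {M N : ℕ → ModuleCat.{u} k} (f : ∀ n, M n ⟶ N n) :
    ModuleCat.of k (∀ n, M n) ⟶ ModuleCat.of k (∀ n, N n) :=
  ModuleCat.ofHom (LinearMap.pi fun n => (f n).hom ∘ₗ LinearMap.proj n)

/-- The map into a product induced by a sequence of maps. -/
def piLift {L : ModuleCat.{u} k} {M : ℕ → ModuleCat.{u} k} (f : ∀ n, L ⟶ M n) :
    L ⟶ ModuleCat.of k (∀ n, M n) :=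
  ModuleCat.ofHom (LinearMap.pi fun n => (f n).hom)

/-- The map on germs induced by a sequence of maps. -/
def germMap {M N : ℕ → ModuleCat.{u} k} (f : ∀ n, M n ⟶ N n) : germ M ⟶ germ N :=
  ModuleCat.ofHom (Submodule.mapQ _ _ (piMap f).hom fun x hx => by
    have hx' : ∀ᶠ n in Filter.atTop, x n = 0 := hx
    change ∀ᶠ n in Filter.atTop, f n (x n) = 0
    filter_upwards [hx'] with n h
    rw [h, map_zero])

lemma germ_hom_ext {M : ℕ → ModuleCat.{u} k} {N : ModuleCat.{u} k} {f g : germ M ⟶ N}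
    (h : ∀ x : ∀ n, M n, f (germMk M x) = g (germMk M x)) : f = g :=
  ConcreteCategory.hom_ext _ _ fun y => by
    obtain ⟨x, rfl⟩ := germMk_surjective y
    exact h x

variable {D : Type u} [SmallCategory D] (ε : ℕ → D ⥤ D)

/-- The functor which sends `X` to the germs at infinity of `n ↦ X (ε n -)`. -/
def germFunctor : (D ⥤ ModuleCat.{u} k) ⥤ (D ⥤ ModuleCat.{u} k) where
  obj X :=
    { obj := fun d => germ fun n => X.obj ((ε n).obj d)
      map := fun f => germMap fun n => X.map ((ε n).map f)
      map_id := fun d => germ_hom_ext fun x => congrArg (germMk _) <| funext fun n => by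
        change X.map ((ε n).map (𝟙 d)) (x n) = x n
        simp
      map_comp := fun f g => germ_hom_ext fun x => congrArg (germMk _) <| funext fun n => by
        change X.map ((ε n).map (f ≫ g)) (x n) = X.map ((ε n).map g) (X.map ((ε n).map f) (x n))
        simp }
  map φ :=
    { app := fun d => germMap fun n => φ.app ((ε n).obj d)
      naturality := fun d d' f => germ_hom_ext fun x => congrArg (germMk _) <| funext fun n =>
        NatTrans.naturality_apply φ ((ε n).map f) (x n) }
  map_id X := NatTrans.ext (funext fun _ => germ_hom_ext fun _ => rfl)
  map_comp f g := NatTrans.ext (funext fun _ => germ_hom_ext fun _ => rfl)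

instance : (germFunctor (k := k) ε).Additive where
  map_add := NatTrans.ext (funext fun _ => germ_hom_ext fun _ => rfl)

/-- Lift term by term at the indices where the sequence is a cycle, which are all the large ones.
The other indices do not affect the germ, and the preimage chosen there is zero. -/
lemma germFunctor_exact (S : ShortComplex (D ⥤ ModuleCat.{u} k)) (hS : S.Exact) :
    (S.map (germFunctor ε)).Exact := by
  refine exact_of_evaluation fun d => ?_
  rw [ShortComplex.moduleCat_exact_iff]
  intro y hy
  obtain ⟨y, rfl⟩ := germMk_surjective y
  have hy' : ∀ᶠ n in Filter.atTop, S.g.app ((ε n).obj d) (y n) = 0 := (germMk_eq_zero _).1 hy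
  have hS' n := (ShortComplex.moduleCat_exact_iff _).1
    (hS.map ((evaluation D (ModuleCat.{u} k)).obj ((ε n).obj d)))
  have h n : ∃ x : S.X₁.obj ((ε n).obj d), S.g.app ((ε n).obj d) (y n) = 0 →
      S.f.app ((ε n).obj d) x = y n := by
    by_cases h0 : S.g.app ((ε n).obj d) (y n) = 0
    · obtain ⟨x, hx⟩ := hS' n (y n) h0
      exact ⟨x, fun _ => hx⟩
    · exact ⟨0, fun h => absurd h h0⟩
  choose x hx using h
  refine ⟨germMk _ x, ?_⟩
  refine germMk_eq_of_eventually (x := fun n => S.f.app ((ε n).obj d) (x n)) ?_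
  filter_upwards [hy'] with n hn
  exact hx n hn

instance : (germFunctor (k := k) ε).PreservesHomology :=
  Functor.preservesHomology_of_map_exact _ fun S hS => germFunctor_exact ε S hS

variable {ε}

/-- The map to germs induced by a sequence of natural transformations. -/
def toGerm {X Y : D ⥤ ModuleCat.{u} k} (ψ : ∀ n, X ⟶ ε n ⋙ Y) : X ⟶ (germFunctor ε).obj Y where
  app d := piLift (fun n => (ψ n).app d) ≫ germMk fun n => Y.obj ((ε n).obj d)
  naturality d d' f := by
    ext x
    change germMk _ (fun n => (ψ n).app d' (X.map f x)) =
      germMk _ fun n => Y.map ((ε n).map f) ((ψ n).app d x)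
    congr 1
    funext n
    exact NatTrans.naturality_apply (ψ n) f x

/-- The map from germs of `n ↦ X (ε n d)` to germs of sequences in the colimit of `X`. -/
noncomputable def germToColim (X : D ⥤ ModuleCat.{u} k) :
    (germFunctor ε).obj X ⟶ (Functor.const D).obj (germ fun _ => colimit X) where
  app d := germMap fun n => colimit.ι X ((ε n).obj d)
  naturality d d' f := germ_hom_ext fun x => by
    change germMk _ (fun n => colimit.ι X _ (X.map ((ε n).map f) (x n))) =
      germMk _ fun n => colimit.ι X _ (x n)
    congr 1
    funext n
    exact ConcreteCategory.congr_hom (colimit.w X ((ε n).map f)) (x n)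

lemma germToColim_naturality {X X' : D ⥤ ModuleCat.{u} k} (f : X ⟶ X') (d : D) :
    ((germFunctor ε).map f).app d ≫ (germToColim X').app d =
      (germToColim X).app d ≫ germMap fun _ => colimMap f := by
  refine germ_hom_ext fun x => congrArg (germMk _) <| funext fun n => ?_
  exact (ConcreteCategory.congr_hom (ι_colimMap f ((ε n).obj d)) (x n)).symm

end Germs

/-! ### Contraction of the colimit of a projective resolution. -/

section Contraction

variable {k : Type u} [CommRing k] {D : Type u} [SmallCategory D]

/-- The restriction to a constant functor. -/
noncomputable abbrev constPullback (d₀ : D) : (D ⥤ ModuleCat.{u} k) ⥤ (D ⥤ ModuleCat.{u} k) :=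
  pullback k ((Functor.const D).obj d₀)

/-- The map from a colimit induced by a map to a constant functor. -/
noncomputable def colimitDesc (X : D ⥤ ModuleCat.{u} k) {d₀ : D} {Y : D ⥤ ModuleCat.{u} k}
    (p : X ⟶ (Functor.const D).obj d₀ ⋙ Y) : colimit X ⟶ Y.obj d₀ :=
  colimit.desc X ⟨Y.obj d₀, ⟨fun d => p.app d, fun d d' f => by
    have h := p.naturality f
    exact h.trans (congrArg (p.app d ≫ ·) (Y.map_id d₀))⟩⟩

@[simp]
lemma ι_colimitDesc (X : D ⥤ ModuleCat.{u} k) {d₀ : D} {Y : D ⥤ ModuleCat.{u} k}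
    (p : X ⟶ (Functor.const D).obj d₀ ⋙ Y) (d : D) :
    colimit.ι X d ≫ colimitDesc X p = p.app d :=
  colimit.ι_desc (F := X) _ d

@[simp]
lemma ι_colimitDesc_assoc (X : D ⥤ ModuleCat.{u} k) {d₀ : D} {Y : D ⥤ ModuleCat.{u} k}
    (p : X ⟶ (Functor.const D).obj d₀ ⋙ Y) (d : D) {N : ModuleCat.{u} k} (f : Y.obj d₀ ⟶ N) :
    colimit.ι X d ≫ colimitDesc X p ≫ f = p.app d ≫ f := by
  rw [← Category.assoc, ι_colimitDesc]

/-- A sequence of natural transformations to translated functors which is compatible with the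
canonical maps to the colimits contracts the colimit of a projective resolution of `Y`, as soon
as it factors eventually through a single value of `Y`. -/
theorem isResolution_colim {R : ChainComplex (D ⥤ ModuleCat.{u} k) ℕ} [∀ n, Projective (R.X n)]
    {Y : D ⥤ ModuleCat.{u} k} {η : R.X 0 ⟶ Y} (hR : IsResolution R η) (d₀ : D)
    (p : Y ⟶ (Functor.const D).obj d₀ ⋙ Y) (hp : p.app d₀ = 𝟙 _) (ε : ℕ → D ⥤ D)
    (σ : ∀ n, (Functor.const D).obj d₀ ⟶ ε n)
    (B : ∀ (n : ℕ) (X : D ⥤ ModuleCat.{u} k), X ⟶ ε n ⋙ X)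
    (hBn : ∀ (n : ℕ) {X X' : D ⥤ ModuleCat.{u} k} (f : X ⟶ X'),
      B n X ≫ Functor.whiskerLeft (ε n) f = f ≫ B n X')
    (hB : ∀ n X d, (B n X).app d ≫ colimit.ι X ((ε n).obj d) = colimit.ι X d)
    (hY : ∀ d (y : Y.obj d), ∀ᶠ n in Filter.atTop,
      (B n Y).app d y = Y.map ((σ n).app d) (p.app d y)) :
    IsResolution ((colim.mapHomologicalComplex (ComplexShape.down ℕ)).obj R)
      (Z := Y.obj d₀) (colimitDesc (R.X 0) (η ≫ p)) := by
  -- a lift of `p`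
  have hc : IsResolution (((constPullback d₀).mapHomologicalComplex _).obj R)
    ((constPullback d₀).map η) := hR.map (constPullback d₀)
  obtain ⟨l, hl⟩ := hc.exists_lift η hR.d_comp p
  let l' (m : ℕ) : R.X m ⟶ (Functor.const D).obj d₀ ⋙ R.X m := l.f m
  have hl' : l' 0 ≫ Functor.whiskerLeft _ η = η ≫ p := hl
  have hl'' (i j : ℕ) : l' i ≫ Functor.whiskerLeft _ (R.d i j) = R.d i j ≫ l' j := l.comm i j
  clear_value l'
  -- the difference of the two lifts
  let ψ (n m : ℕ) : R.X m ⟶ ε n ⋙ R.X m := B n (R.X m) - l' m ≫ Functor.whiskerRight (σ n) (R.X m)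
  have hψ (n i j : ℕ) : ψ n i ≫ Functor.whiskerLeft _ (R.d i j) = R.d i j ≫ ψ n j := by
    have h2 : Functor.whiskerRight (σ n) (R.X i) ≫ Functor.whiskerLeft _ (R.d i j) =
        Functor.whiskerLeft _ (R.d i j) ≫ Functor.whiskerRight (σ n) (R.X j) :=
      NatTrans.ext (funext fun d => (R.d i j).naturality _)
    simp only [ψ, Preadditive.sub_comp, Preadditive.comp_sub, Category.assoc, hBn, h2,
      reassoc_of% hl'']
  -- For a fixed `n`, `ψ n` need not lift zero: the index from which `hY` holds depends on the
  -- element. The sequence of all the `ψ n`, taken as a germ, does lift zero.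
  let χ : R ⟶ ((germFunctor ε).mapHomologicalComplex _).obj R :=
    { f := fun m => toGerm fun n => ψ n m
      comm' := fun i j _ => NatTrans.ext (funext fun d => ConcreteCategory.hom_ext _ _ fun x =>
        congrArg (germMk _) <| funext fun n =>
          ConcreteCategory.congr_hom (NatTrans.congr_app (hψ n i j) d) x) }
  let Bx (n m : ℕ) (d : D) : (R.X m).obj d ⟶ (R.X m).obj ((ε n).obj d) := (B n (R.X m)).app d
  have hψ' (n m : ℕ) (d : D) (x : (R.X m).obj d) : (ψ n m).app d x =
      Bx n m d x - (R.X m).map ((σ n).app d) ((l' m).app d x) := rfl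
  have hχ : χ.f 0 ≫ (germFunctor ε).map η = 0 := by
    refine NatTrans.ext (funext fun d => ConcreteCategory.hom_ext _ _ fun x => ?_)
    refine (germMk_eq_zero fun n => η.app _ ((ψ n 0).app d x)).2 ?_
    filter_upwards [hY d (η.app d x)] with n hn
    have h1 : η.app _ ((B n (R.X 0)).app d x) = (B n Y).app d (η.app d x) :=
      ConcreteCategory.congr_hom (NatTrans.congr_app (hBn n η) d) x
    have h2 : η.app d₀ ((l' 0).app d x) = p.app d (η.app d x) :=
      ConcreteCategory.congr_hom (NatTrans.congr_app hl' d) x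
    have h3 := NatTrans.naturality_apply η ((σ n).app d) ((l' 0).app d x)
    refine (congrArg _ (hψ' n 0 d x)).trans ((map_sub _ _ _).trans ?_)
    refine sub_eq_zero.2 (h1.trans (hn.trans ?_))
    rw [← h2]
    exact h3.symm
  let χ' (m : ℕ) : R.X m ⟶ (germFunctor ε).obj (R.X m) := toGerm fun n => ψ n m
  obtain ⟨H⟩ := (hR.map (germFunctor ε)).nonempty_homotopy χ hχ
  let H' (i j : ℕ) : R.X i ⟶ (germFunctor ε).obj (R.X j) := H.hom i j
  have hH'₀ : χ' 0 = H' 0 1 ≫ (germFunctor ε).map (R.d 1 0) := by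
    refine (H.comm 0).trans ?_
    rw [Homotopy.dNext_zero_chainComplex, Homotopy.prevD_chainComplex, zero_add]
    exact add_zero _
  have hH' (m : ℕ) : χ' (m + 1) = R.d (m + 1) m ≫ H' m (m + 1) +
      H' (m + 1) (m + 2) ≫ (germFunctor ε).map (R.d (m + 2) (m + 1)) := by
    refine (H.comm (m + 1)).trans ?_
    rw [Homotopy.dNext_succ_chainComplex, Homotopy.prevD_chainComplex]
    exact add_zero _
  clear_value H'
  -- the corresponding maps on colimits
  let a : colimit (R.X 0) ⟶ Y.obj d₀ := colimitDesc (R.X 0) (η ≫ p)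
  let lc (m : ℕ) : colimit (R.X m) ⟶ (R.X m).obj d₀ := colimitDesc (R.X m) (l' m)
  let dc (i j : ℕ) : colimit (R.X i) ⟶ colimit (R.X j) := colimMap (R.d i j)
  let e (m : ℕ) : colimit (R.X m) ⟶ colimit (R.X m) := 𝟙 _ - lc m ≫ colimit.ι (R.X m) d₀
  let δ (m : ℕ) : colimit (R.X m) ⟶ germ fun _ => colimit (R.X m) :=
    piLift (fun _ => 𝟙 _) ≫ germMk _
  let h (i j : ℕ) : colimit (R.X i) ⟶ germ fun _ => colimit (R.X j) :=
    colimit.desc (R.X i) ⟨_, H' i j ≫ germToColim (R.X j)⟩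
  -- The homotopy takes values in germs of `R` along the `ε n`. Composed with `germToColim` it
  -- becomes compatible with all morphisms of `D`, hence descends to the colimit.
  have hh (i j : ℕ) (d : D) : colimit.ι (R.X i) d ≫ h i j =
    (H' i j).app d ≫ (germToColim (R.X j)).app d := colimit.ι_desc _ _
  -- On the colimit the sequence `ψ n` becomes constant in `n`: `B n` becomes the identity by `hB`,
  -- and `σ n` disappears because it is a morphism of `D` starting at `d₀`.
  have hχc (m : ℕ) (d : D) : colimit.ι (R.X m) d ≫ e m ≫ δ m =
      (χ' m).app d ≫ (germToColim (R.X m)).app d := by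
    refine ConcreteCategory.hom_ext _ _ fun x => ?_
    refine congrArg (germMk _) <| funext fun n => ?_
    change (colimit.ι (R.X m) d ≫ (𝟙 _ - lc m ≫ colimit.ι (R.X m) d₀)) x =
      colimit.ι (R.X m) _ (Bx n m d x - (R.X m).map ((σ n).app d) ((l' m).app d x))
    have h1 : colimit.ι (R.X m) _ (Bx n m d x) = colimit.ι (R.X m) d x :=
      ConcreteCategory.congr_hom (hB n (R.X m) d) x
    have h2 : colimit.ι (R.X m) ((ε n).obj d) ((R.X m).map ((σ n).app d) ((l' m).app d x)) =
        colimit.ι (R.X m) d₀ ((l' m).app d x) :=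
      ConcreteCategory.congr_hom (colimit.w (R.X m) ((σ n).app d)) _
    have h3 : colimit.ι (R.X m) d ≫ (𝟙 _ - lc m ≫ colimit.ι (R.X m) d₀) =
        colimit.ι (R.X m) d - (l' m).app d ≫ colimit.ι (R.X m) d₀ := by
      rw [Preadditive.comp_sub, Category.comp_id, ← Category.assoc, ι_colimitDesc]
    rw [h3]
    refine Eq.trans ?_ (map_sub _ _ _).symm
    rw [h1]
    exact congrArg _ h2.symm
  -- Two sequences with the same germ agree at some index, so a single `n` turns the boundary of
  -- germs into an actual boundary.
  have hδ (m : ℕ) (z : (colimit (R.X m) : ModuleCat.{u} k))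
      (w : (germ fun _ => colimit (R.X (m + 1)) : ModuleCat.{u} k))
      (hw : δ m (e m z) = germMap (fun _ => dc (m + 1) m) w) :
      ∃ y, z - colimit.ι (R.X m) d₀ (lc m z) = dc (m + 1) m y := by
    obtain ⟨w, rfl⟩ := germMk_surjective w
    have h0 : germMk (fun _ => colimit (R.X m)) (fun n => e m z - dc (m + 1) m (w n)) = 0 :=
      (map_sub (germMk (fun _ => colimit (R.X m))).hom _ _).trans (sub_eq_zero.2 hw)
    obtain ⟨n, hn⟩ := ((germMk_eq_zero _).1 h0).exists
    exact ⟨w n, sub_eq_zero.1 hn⟩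
  have hH₀ (z : (colimit (R.X 0) : ModuleCat.{u} k)) :
      δ 0 (e 0 z) = germMap (fun _ => dc 1 0) (h 0 1 z) := by
    have h1 : e 0 ≫ δ 0 = h 0 1 ≫ germMap (fun _ => dc 1 0) := by
      refine colimit.hom_ext fun d => ?_
      rw [hχc, reassoc_of% hh, hH'₀, NatTrans.comp_app, Category.assoc, germToColim_naturality]
    exact ConcreteCategory.congr_hom h1 z
  have hH (m : ℕ) (z : (colimit (R.X (m + 1)) : ModuleCat.{u} k)) (hz : dc (m + 1) m z = 0) :
      δ (m + 1) (e (m + 1) z) =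
        germMap (fun _ => dc (m + 2) (m + 1)) (h (m + 1) (m + 2) z) := by
    have h1 : e (m + 1) ≫ δ (m + 1) = dc (m + 1) m ≫ h m (m + 1) +
        h (m + 1) (m + 2) ≫ germMap (fun _ => dc (m + 2) (m + 1)) := by
      refine colimit.hom_ext fun d => ?_
      rw [hχc, Preadditive.comp_add, reassoc_of% hh, hH', NatTrans.app_add, NatTrans.comp_app,
        NatTrans.comp_app, Preadditive.add_comp, Category.assoc, Category.assoc,
        germToColim_naturality]
      congr 1
      rw [ι_colimMap_assoc, hh]
    refine (ConcreteCategory.congr_hom h1 z).trans ?_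
    change h m (m + 1) (dc (m + 1) m z) + _ = _
    rw [hz, map_zero, zero_add]
    rfl
  -- exactness
  have hev := hR.map ((evaluation D (ModuleCat.{u} k)).obj d₀)
  have ha₁ : colimit.ι (R.X 0) d₀ ≫ a = η.app d₀ := by
    refine (ι_colimitDesc _ _ _).trans ?_
    rw [NatTrans.comp_app, hp]
    exact Category.comp_id _
  have ha₂ : lc 0 ≫ η.app d₀ = a := by
    refine colimit.hom_ext fun d => ?_
    rw [ι_colimitDesc_assoc, ι_colimitDesc, ← hl']
    rfl
  have hlc (i j : ℕ) : lc i ≫ (R.d i j).app d₀ = dc i j ≫ lc j := by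
    refine colimit.hom_ext fun d => ?_
    rw [ι_colimitDesc_assoc, ι_colimMap_assoc, ι_colimitDesc]
    exact NatTrans.congr_app (hl'' i j) d
  have hι (i j : ℕ) (x : (R.X i).obj d₀) :
      colimit.ι (R.X j) d₀ ((R.d i j).app d₀ x) = dc i j (colimit.ι (R.X i) d₀ x) :=
    (ConcreteCategory.congr_hom (ι_colimMap (R.d i j) d₀) x).symm
  have hd : dc 1 0 ≫ a = 0 := by
    refine colimit.hom_ext fun d => ?_
    rw [ι_colimMap_assoc, ι_colimitDesc, ← NatTrans.comp_app, ← Category.assoc, hR.d_comp,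
      zero_comp, comp_zero]
    rfl
  -- A cycle `z` is homologous to the image of `lc i z`, a cycle at `d₀`, where the complex is
  -- exact; the two boundaries add up to `z`.
  have hex (i : ℕ) (z : (colimit (R.X i) : ModuleCat.{u} k))
      (x : (R.X (i + 1)).obj d₀) (hx : (R.d (i + 1) i).app d₀ x = lc i z)
      (hz : ∃ y, z - colimit.ι (R.X i) d₀ (lc i z) = dc (i + 1) i y) :
      ∃ y, dc (i + 1) i y = z := by
    obtain ⟨y, hy⟩ := hz
    refine ⟨y + colimit.ι (R.X (i + 1)) d₀ x, ?_⟩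
    rw [map_add, ← hy, ← hι, hx, sub_add_cancel]
  have hex₀ (z : (colimit (R.X 0) : ModuleCat.{u} k)) (hz : a z = 0) : ∃ y, dc 1 0 y = z := by
    obtain ⟨x, hx⟩ := (ShortComplex.moduleCat_exact_iff _).1 hev.exact₀ (lc 0 z)
      ((ConcreteCategory.congr_hom ha₂ z).trans hz)
    exact hex 0 z x hx (hδ 0 z _ (hH₀ z))
  have hex₁ (m : ℕ) (z : (colimit (R.X (m + 1)) : ModuleCat.{u} k)) (hz : dc (m + 1) m z = 0) :
      ∃ y, dc (m + 2) (m + 1) y = z := by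
    have h0 : (R.d (m + 1) m).app d₀ (lc (m + 1) z) = 0 :=
      (ConcreteCategory.congr_hom (hlc (m + 1) m) z).trans
        ((congrArg (lc m) hz).trans (map_zero (lc m).hom))
    obtain ⟨x, hx⟩ := (ShortComplex.moduleCat_exact_iff _).1 (hev.exact_succ m) (lc (m + 1) z) h0
    exact hex (m + 1) z x hx (hδ (m + 1) z _ (hH m z hz))
  have : Epi (η.app d₀) := hev.epi
  exact ⟨epi_of_epi_fac ha₁, hd, (ShortComplex.moduleCat_exact_iff _).2 hex₀,
    fun m => (ShortComplex.moduleCat_exact_iff _).2 (hex₁ m)⟩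

end Contraction

/-! ### Projectivity of restrictions to the fibers of a functor. -/

section ProjectiveRestriction

variable {k : Type u} [CommRing k] {C B : Type u} [SmallCategory C] [SmallCategory B]

lemma epi_sigmaDesc_fromStandard (P : C ⥤ ModuleCat.{u} k) :
    Epi (Sigma.desc fun i : (Σ c : C, P.obj c) => fromStandard P i.1 i.2) := by
  have (c : C) : Epi ((Sigma.desc fun i : (Σ c : C, P.obj c) =>
      fromStandard P i.1 i.2).app c) := by
    rw [ModuleCat.epi_iff_surjective]
    intro y
    refine ⟨(Sigma.ι (fun i : (Σ c : C, P.obj c) => standardProjective k i.1)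
      ⟨c, y⟩).app c (ModuleCat.freeMk (𝟙 c)), ?_⟩
    have h : Sigma.ι (fun i : (Σ c : C, P.obj c) => standardProjective k i.1) ⟨c, y⟩ ≫
        Sigma.desc (fun i : (Σ c : C, P.obj c) => fromStandard P i.1 i.2) =
          fromStandard P c y := Sigma.ι_desc _ _
    exact (ConcreteCategory.congr_hom (NatTrans.congr_app h c) _).trans (fromStandard_app P c y)
  exact NatTrans.epi_of_epi_app _

variable (β : C ⥤ B) (t : B)

/-- A morphism `φ : c ⟶ d.left` is a morphism to `d` from exactly one object over `c`, namely the
one with structural map `β.map φ ≫ d.hom`. The restriction of `k[C(c, -)]` is thus the sum over all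
`a : β.obj c ⟶ t` of the standard projectives at `(c, a)`, and a lift amounts to one preimage `y a`
for each `a`. -/
instance projective_pullback_standardProjective (c : C) :
    Projective ((pullback k (CostructuredArrow.proj β t)).obj (standardProjective k c)) where
  factors {E X} f e _ := by
    have h (a : β.obj c ⟶ t) : ∃ y : E.obj (CostructuredArrow.mk a),
        e.app _ y = f.app (CostructuredArrow.mk a) (ModuleCat.freeMk (𝟙 c)) :=
      (ModuleCat.epi_iff_surjective (e.app (CostructuredArrow.mk a))).mp inferInstance _
    choose y hy using h
    have hE {d d' : CostructuredArrow β t} (g : d ⟶ d') (φ : c ⟶ d.left) (ψ : c ⟶ d'.left)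
        (hψ : φ ≫ g.left = ψ) :
        E.map g (E.map (CostructuredArrow.homMk φ rfl :
          CostructuredArrow.mk (β.map φ ≫ d.hom) ⟶ d) (y _)) =
        E.map (CostructuredArrow.homMk ψ rfl :
          CostructuredArrow.mk (β.map ψ ≫ d'.hom) ⟶ d') (y _) := by
      -- The two structural maps over `c` are only propositionally equal; as variables they can be
      -- identified before the preimages are compared.
      have key (a a' : β.obj c ⟶ t) (w : β.map φ ≫ d.hom = a) (w' : β.map ψ ≫ d'.hom = a')
          (haa' : a = a') :
          E.map g (E.map (CostructuredArrow.homMk φ w : CostructuredArrow.mk a ⟶ d) (y a)) =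
            E.map (CostructuredArrow.homMk ψ w' : CostructuredArrow.mk a' ⟶ d') (y a') := by
        subst haa'
        rw [← ConcreteCategory.comp_apply, ← E.map_comp]
        congr 3
        ext
        exact hψ
      refine key _ _ rfl rfl ?_
      rw [← hψ, β.map_comp, Category.assoc, CostructuredArrow.w]
    let A (d : CostructuredArrow β t) : (standardProjective k c).obj d.left ⟶ E.obj d :=
      ModuleCat.freeDesc (↾fun φ : c ⟶ d.left => E.map (CostructuredArrow.homMk φ rfl :
        CostructuredArrow.mk (β.map φ ≫ d.hom) ⟶ d) (y _))
    have hA (d : CostructuredArrow β t) (φ : c ⟶ d.left) : A d (ModuleCat.freeMk φ) =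
        E.map (CostructuredArrow.homMk φ rfl : CostructuredArrow.mk (β.map φ ≫ d.hom) ⟶ d) (y _) :=
      ModuleCat.freeDesc_apply _ _
    refine ⟨{ app := A
              naturality := fun d d' g => ModuleCat.free_hom_ext fun φ => ?_ },
      NatTrans.ext (funext fun d => ModuleCat.free_hom_ext fun φ => ?_)⟩
    · have h1 : (standardProjective k c).map g.left (ModuleCat.freeMk φ) =
          ModuleCat.freeMk (φ ≫ g.left) :=
        ModuleCat.free_map_apply ((coyoneda.obj (op c)).map g.left) φ
      refine (congrArg (A d') h1).trans ?_
      refine (hA d' _).trans ?_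
      refine (hE g φ _ rfl).symm.trans ?_
      exact congrArg (E.map g) (hA d φ).symm
    · refine (congrArg (e.app d) (hA d φ)).trans ?_
      refine (NatTrans.naturality_apply e _ _).trans ?_
      refine (congrArg _ (hy _)).trans ?_
      have h1 : (standardProjective k c).map φ (ModuleCat.freeMk (𝟙 c)) = ModuleCat.freeMk φ :=
        (ModuleCat.free_map_apply ((coyoneda.obj (op c)).map φ) (𝟙 c)).trans (by simp)
      refine (NatTrans.naturality_apply f (CostructuredArrow.homMk φ rfl :
        CostructuredArrow.mk (β.map φ ≫ d.hom) ⟶ d) _).symm.trans ?_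
      exact congrArg (f.app d) h1

/-- A projective functor is a retract of a sum of standard ones, and restriction preserves sums. -/
instance pullback_proj_preservesProjectiveObjects :
    (pullback k (CostructuredArrow.proj β t)).PreservesProjectiveObjects where
  projective_obj {P} hP := by
    let E := pullback k (CostructuredArrow.proj β t)
    let S := fun i : (Σ c : C, P.obj c) => standardProjective k i.1
    let q : ∐ S ⟶ P := Sigma.desc fun i => fromStandard P i.1 i.2
    have hq : Epi q := epi_sigmaDesc_fromStandard P
    have h1 : Projective (E.obj (∐ S)) :=
      Projective.of_iso (PreservesCoproduct.iso E S).symm inferInstance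
    exact (Retract.mk (E.map (Projective.factorThru (𝟙 P) q)) (E.map q) (by
      rw [← E.map_comp, Projective.factorThru_comp, E.map_id])).projective

end ProjectiveRestriction

/-! ### Iterated coproducts and alternating sums over extensions. -/

section Iterate

variable {T : Type u} [SmallCategory T] [HasFiniteCoproducts T]

/-- The coproduct of `a` and of `n` copies of `c`. -/
noncomputable def iter (a c : T) : ℕ → T
  | 0 => a
  | n + 1 => iter a c n ⨿ c

/-- The canonical inclusion of `a`. -/
noncomputable def iterIncl (a c : T) : ∀ n, a ⟶ iter a c n
  | 0 => 𝟙 a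
  | n + 1 => iterIncl a c n ≫ (coprod.inl : _ ⟶ iter a c n ⨿ c)

/-- The functoriality of `iter`. -/
noncomputable def iterMap (a : T) {c c' : T} (f : c ⟶ c') : ∀ n, iter a c n ⟶ iter a c' n
  | 0 => 𝟙 a
  | n + 1 => coprod.map (iterMap a f n) f

lemma iterMap_id (a c : T) : ∀ n, iterMap a (𝟙 c) n = 𝟙 (iter a c n)
  | 0 => rfl
  | n + 1 => by
    rw [iterMap, iterMap_id a c n]
    exact coprod.map_id_id

lemma iterMap_comp (a : T) {c c' c'' : T} (f : c ⟶ c') (g : c' ⟶ c'') :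
    ∀ n, iterMap a (f ≫ g) n = iterMap a f n ≫ iterMap a g n
  | 0 => (Category.id_comp (𝟙 a)).symm
  | n + 1 => by
    rw [iterMap, iterMap_comp a f g n]
    exact (coprod.map_map _ _ _ _).symm

lemma iterMap_retract (a : T) {c c' : T} {u : c ⟶ c'} {v : c' ⟶ c} (h : u ≫ v = 𝟙 c) (n : ℕ) :
    iterMap a u n ≫ iterMap a v n = 𝟙 _ := by
  rw [← iterMap_comp, h, iterMap_id]

lemma iterIncl_iterMap (a : T) {c c' : T} (f : c ⟶ c') :
    ∀ n, iterIncl a c n ≫ iterMap a f n = iterIncl a c' n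
  | 0 => Category.id_comp (𝟙 a)
  | n + 1 => by
    change (iterIncl a c n ≫ (coprod.inl : _ ⟶ iter a c n ⨿ c)) ≫ coprod.map (iterMap a f n) f =
      iterIncl a c' n ≫ (coprod.inl : _ ⟶ iter a c' n ⨿ c')
    rw [Category.assoc, coprod.inl_map, ← Category.assoc, iterIncl_iterMap a f n]

/-- The projection which forgets the last copy of `c`. -/
noncomputable def iterDrop [HasZeroMorphisms T] (a c : T) (n : ℕ) : iter a c (n + 1) ⟶ iter a c n :=
  (coprod.desc (𝟙 _) 0 : iter a c n ⨿ c ⟶ iter a c n)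

/-- The extensions of `f : a ⟶ c` to the coproduct of `a` and of `n` copies of `c`. -/
structure Extension {a c : T} (f : a ⟶ c) (n : ℕ) where
  /-- The underlying morphism. -/
  hom : iter a c n ⟶ c
  comp : iterIncl a c n ≫ hom = f

namespace Extension

variable {a c : T} {f : a ⟶ c}

/-- The extension `f` itself. -/
def base (f : a ⟶ c) : Extension f 0 := ⟨f, Category.id_comp f⟩

/-- The extension by `h` on the last copy. -/
noncomputable def extend {n : ℕ} (ρ : Extension f n) (h : c ⟶ c) : Extension f (n + 1) :=
  ⟨coprod.desc ρ.hom h, by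
    change (iterIncl a c n ≫ (coprod.inl : _ ⟶ iter a c n ⨿ c)) ≫ coprod.desc ρ.hom h = f
    rw [Category.assoc, coprod.inl_desc]
    exact ρ.comp⟩

variable [HasZeroMorphisms T]

lemma iterDrop_comp {n : ℕ} (ρ : Extension f n) : iterDrop a c n ≫ ρ.hom = (ρ.extend 0).hom :=
  (coprod.desc_comp _ _ _).trans (by rw [Category.id_comp, zero_comp]; rfl)

variable {M N : Type*} [AddCommGroup M] [AddCommGroup N]

/-- The alternating sum of the values of `Φ` on those extensions of `f` to the coproduct of `a`
and of `n` copies of `c` which are zero or the identity on each copy. -/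
noncomputable def alt (f : a ⟶ c) : ∀ n, (Extension f n → M) → M
  | 0, Φ => Φ (base f)
  | n + 1, Φ => alt f n (fun ρ => Φ (ρ.extend 0)) - alt f n (fun ρ => Φ (ρ.extend (𝟙 c)))

lemma map_alt (φ : M →+ N) : ∀ (n : ℕ) (Φ : Extension f n → M),
    φ (alt f n Φ) = alt f n fun ρ => φ (Φ ρ)
  | 0, _ => rfl
  | n + 1, Φ => by rw [alt, map_sub, map_alt φ n, map_alt φ n, alt]

/-- The two halves of the sum cancel. In order zero there is a single term and no cancellation. -/
lemma alt_const (m : M) (n : ℕ) : alt f (n + 1) (fun _ => m) = 0 := sub_self _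

lemma alt_add : ∀ (n : ℕ) (Φ Ψ : Extension f n → M),
    alt f n (fun ρ => Φ ρ + Ψ ρ) = alt f n Φ + alt f n Ψ
  | 0, _, _ => rfl
  | n + 1, Φ, Ψ => by
    simp only [alt, alt_add n]
    abel

/-- Both sums are built by the same sequence of choices between zero and the identity, so extensions
made by the same choices can be compared one by one; `r` is any relation that these choices
preserve. -/
lemma alt_congr {a' c' : T} {f' : a' ⟶ c'} (r : ∀ n, Extension f n → Extension f' n → Prop)
    (h₀ : r 0 (base f) (base f'))
    (h₁ : ∀ n ρ ρ', r n ρ ρ' → r (n + 1) (ρ.extend 0) (ρ'.extend 0))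
    (h₂ : ∀ n ρ ρ', r n ρ ρ' → r (n + 1) (ρ.extend (𝟙 c)) (ρ'.extend (𝟙 c'))) :
    ∀ (n : ℕ) (Φ : Extension f n → M) (Φ' : Extension f' n → M),
      (∀ ρ ρ', r n ρ ρ' → Φ ρ = Φ' ρ') → alt f n Φ = alt f' n Φ'
  | 0, _, _, h => h _ _ h₀
  | n + 1, Φ, Φ', h => by
    rw [alt, alt, alt_congr r h₀ h₁ h₂ n _ _ fun ρ ρ' hr => h _ _ (h₁ n ρ ρ' hr),
      alt_congr r h₀ h₁ h₂ n _ _ fun ρ ρ' hr => h _ _ (h₂ n ρ ρ' hr)]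

/-- Zero and the identity commute with every `v`, so extensions made by the same choices are
intertwined by `v`. This is what makes the alternating sums natural. -/
lemma alt_congr_of_comm {c' : T} {f' : a ⟶ c'} (v : c' ⟶ c) (hv : f' ≫ v = f) (n : ℕ)
    (Φ : Extension f n → M) (Φ' : Extension f' n → M)
    (h : ∀ ρ ρ', iterMap a v n ≫ ρ.hom = ρ'.hom ≫ v → Φ ρ = Φ' ρ') : alt f n Φ = alt f' n Φ' := by
  refine alt_congr (fun n ρ ρ' => iterMap a v n ≫ ρ.hom = ρ'.hom ≫ v) ?_ ?_ ?_ n Φ Φ' h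
  · exact (Category.id_comp f).trans hv.symm
  · intro n ρ ρ' hr
    change coprod.map (iterMap a v n) v ≫ coprod.desc ρ.hom 0 = coprod.desc ρ'.hom 0 ≫ v
    rw [coprod.map_desc, coprod.desc_comp, hr, comp_zero, zero_comp]
  · intro n ρ ρ' hr
    change coprod.map (iterMap a v n) v ≫ coprod.desc ρ.hom (𝟙 c) = coprod.desc ρ'.hom (𝟙 c') ≫ v
    rw [coprod.map_desc, coprod.desc_comp, hr, Category.comp_id, Category.id_comp]

end Extension

end Iterate

/-! ### Stability of a subcategory of `S(T)` under coproducts. -/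

namespace SCat

variable {T : Type u} [SmallCategory T] [HasFiniteCoproducts T] [HasZeroMorphisms T]
  {W : MorphismProperty (SCat T)}

lemma canonical_of_iso {x y : T} (e : x ≅ y) :
    canonical T (⟨e.hom, e.inv, e.hom_inv_id⟩ : SCat.mk x ⟶ SCat.mk y) := by
  obtain ⟨t, e', h₁, h₂⟩ := (canonical_isMultiplicative (T := T)).id_mem (SCat.mk x)
  refine ⟨t, e.symm ≪≫ e', ?_, ?_⟩
  · change e.hom ≫ e.inv ≫ e'.hom = _
    rw [e.hom_inv_id_assoc]
    exact (Category.id_comp _).symm.trans h₁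
  · change (e.inv ≫ e'.hom) ≫ _ = e.inv
    rw [Category.assoc]
    exact (congrArg (e.inv ≫ ·) h₂).trans (Category.comp_id _)

lemma canonical_inl (x t : T) :
    canonical T (⟨coprod.inl, coprod.desc (𝟙 x) 0, coprod.inl_desc _ _⟩ :
      SCat.mk x ⟶ SCat.mk (x ⨿ t)) :=
  ⟨t, Iso.refl _, Category.comp_id _, Category.id_comp _⟩

/-- Translations act on one side only: translate `(u, v)` by `y`, exchange the summands, translate
`(u', v')` by `x'` and exchange back. The exchanges are isomorphisms, hence canonical. -/
lemma coprodMap_mem [W.IsMultiplicative] (hW : canonical T ≤ W) (hs : IsStable W)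
    {x x' y y' : T} (u : x ⟶ x') (v : x' ⟶ x) (h : u ≫ v = 𝟙 x) (u' : y ⟶ y') (v' : y' ⟶ y)
    (h' : u' ≫ v' = 𝟙 y) (hf : W (⟨u, v, h⟩ : SCat.mk x ⟶ SCat.mk x'))
    (hg : W (⟨u', v', h'⟩ : SCat.mk y ⟶ SCat.mk y')) :
    W (⟨coprod.map u u', coprod.map v v', by simp [h, h']⟩ :
      SCat.mk (x ⨿ y) ⟶ SCat.mk (x' ⨿ y')) := by
  have h₁ := hs.translate _ y hf
  have h₂ := hW _ (canonical_of_iso (coprod.braiding x' y))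
  have h₃ := hs.translate _ x' hg
  have h₄ := hW _ (canonical_of_iso (coprod.braiding y' x'))
  have h₅ := W.comp_mem _ _ h₁ (W.comp_mem _ _ h₂ (W.comp_mem _ _ h₃ h₄))
  have e₁ : coprod.map u (𝟙 y) ≫ (coprod.braiding x' y).hom ≫ coprod.map u' (𝟙 x') ≫
      (coprod.braiding y' x').hom = coprod.map u u' := by
    refine coprod.hom_ext ?_ ?_ <;> simp [coprod.inl_desc, coprod.inr_desc]
  have e₂ : (((coprod.braiding y' x').inv ≫ coprod.map v' (𝟙 x')) ≫
      (coprod.braiding x' y).inv) ≫ coprod.map v (𝟙 y) = coprod.map v v' := by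
    refine coprod.hom_ext ?_ ?_ <;> simp [coprod.inl_desc, coprod.inr_desc]
  convert h₅ using 1
  exact Retract.mk.injEq .. |>.mpr ⟨e₁.symm, e₂.symm⟩

lemma iterMap_mem [W.IsMultiplicative] (hW : canonical T ≤ W) (hs : IsStable W) (a : T)
    {c c' : T} (u : c ⟶ c') (v : c' ⟶ c) (h : u ≫ v = 𝟙 c)
    (hf : W (⟨u, v, h⟩ : SCat.mk c ⟶ SCat.mk c')) : ∀ n,
    W (⟨iterMap a u n, iterMap a v n, iterMap_retract a h n⟩ :
      SCat.mk (iter a c n) ⟶ SCat.mk (iter a c' n))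
  | 0 => W.id_mem (SCat.mk a)
  | n + 1 => coprodMap_mem hW hs _ _ _ _ _ _ (iterMap_mem hW hs a u v h hf n) hf

end SCat

/-! ### The fibers of `β`, and natural transformations inducing the identity on colimits. -/

section Fiber

variable {T : Type u} [SmallCategory T]
  (W : MorphismProperty (SCat T)) [W.IsMultiplicative] (a : T)

/-- The category of the pairs of an object `c` and a morphism `a ⟶ c` of `T`, with the morphisms
of the subcategory of `S(T)` given by `W`. -/
abbrev Fiber := CostructuredArrow (restrictedToOp W) (op a)

namespace Fiber

variable {W a}

/-- The underlying object of `T`. -/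
abbrev pt (d : Fiber W a) : T := d.left.obj.obj

/-- The structural morphism. -/
abbrev str (d : Fiber W a) : a ⟶ d.pt := d.hom.unop

variable (W) in
/-- The object of `Fiber W a` given by a morphism. -/
abbrev mk {c : T} (f : a ⟶ c) : Fiber W a :=
  CostructuredArrow.mk (Y := (⟨⟨c⟩⟩ : WideSubcategory W)) (S := restrictedToOp W) f.op

/-- The inclusion part of a morphism. -/
abbrev inc {d d' : Fiber W a} (g : d ⟶ d') : d.pt ⟶ d'.pt := SCat.i g.left.hom

/-- The retraction part of a morphism. -/
abbrev ret {d d' : Fiber W a} (g : d ⟶ d') : d'.pt ⟶ d.pt := SCat.r g.left.hom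

lemma inc_ret {d d' : Fiber W a} (g : d ⟶ d') : inc g ≫ ret g = 𝟙 d.pt :=
  Retract.retract g.left.hom

lemma str_ret {d d' : Fiber W a} (g : d ⟶ d') : d'.str ≫ ret g = d.str :=
  congrArg Quiver.Hom.unop (CostructuredArrow.w g)

/-- Constructor for morphisms of `Fiber W a`. -/
def homMk {d d' : Fiber W a} (u : d.pt ⟶ d'.pt) (v : d'.pt ⟶ d.pt) (h : u ≫ v = 𝟙 d.pt)
    (hW : W (⟨u, v, h⟩ : SCat.mk d.pt ⟶ SCat.mk d'.pt)) (hv : d'.str ≫ v = d.str) : d ⟶ d' :=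
  CostructuredArrow.homMk ⟨⟨u, v, h⟩, hW⟩ (congrArg Quiver.Hom.op hv)

lemma hom_ext {d d' : Fiber W a} {g g' : d ⟶ d'} (h : inc g = inc g') (h' : ret g = ret g') :
    g = g' := by
  refine CostructuredArrow.hom_ext _ _ (InducedWideCategory.Hom.ext ?_)
  have key : ∀ x x' : Retract d.pt d'.pt, x.i = x'.i → x.r = x'.r → x = x' := by
    rintro ⟨_, _, _⟩ ⟨_, _, _⟩ rfl rfl
    rfl
  exact key _ _ h h'

variable [HasFiniteCoproducts T] [HasZeroMorphisms T]

section

variable (hW : SCat.canonical T ≤ W) (hs : SCat.IsStable W)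

variable (a) in
/-- The endofunctor which adds `n` copies of an object to `a`. -/
noncomputable def iterFunctor (n : ℕ) : Fiber W a ⥤ Fiber W a where
  obj d := mk W (iterIncl a d.pt n)
  map g := homMk (iterMap a (inc g) n) (iterMap a (ret g) n)
    (iterMap_retract a (inc_ret g) n)
    (SCat.iterMap_mem hW hs a (inc g) (ret g) (inc_ret g) g.left.property n)
    (iterIncl_iterMap a (ret g) n)
  map_id d := hom_ext (iterMap_id a d.pt n) (iterMap_id a d.pt n)
  map_comp f g := hom_ext (iterMap_comp a (inc f) (inc g) n) (iterMap_comp a (ret g) (ret f) n)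

variable (a) in
/-- The inclusion of `n` copies into `n + 1` copies. -/
noncomputable def stabilize (n : ℕ) : iterFunctor a hW hs n ⟶ iterFunctor a hW hs (n + 1) where
  app d := homMk (d := mk W (iterIncl a d.pt n)) (d' := mk W (iterIncl a d.pt (n + 1)))
    (coprod.inl : _ ⟶ iter a d.pt n ⨿ d.pt) (coprod.desc (𝟙 _) 0) (coprod.inl_desc _ _)
    (hW _ (SCat.canonical_inl _ _)) (by
      change (iterIncl a d.pt n ≫ (coprod.inl : _ ⟶ iter a d.pt n ⨿ d.pt)) ≫
        coprod.desc (𝟙 _) 0 = iterIncl a d.pt n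
      rw [Category.assoc, coprod.inl_desc, Category.comp_id])
  naturality d d' g := by
    refine hom_ext ?_ ?_
    · change iterMap a (inc g) n ≫ coprod.inl = coprod.inl ≫ coprod.map (iterMap a (inc g) n) _
      rw [coprod.inl_map]
    · change coprod.desc (𝟙 _) 0 ≫ iterMap a (ret g) n =
        coprod.map (iterMap a (ret g) n) (ret g) ≫ coprod.desc (𝟙 _) 0
      rw [coprod.desc_comp, coprod.map_desc, Category.id_comp, Category.comp_id, zero_comp,
        comp_zero]

variable (a) in
/-- The inclusion of `a` into the coproduct of `a` and `n` copies of an object. -/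
noncomputable def unit : ∀ n, (Functor.const (Fiber W a)).obj (mk W (𝟙 a)) ⟶ iterFunctor a hW hs n
  | 0 => { app := fun _ => 𝟙 _
           naturality := fun _ _ _ => hom_ext rfl rfl }
  | n + 1 => unit n ≫ stabilize a hW hs n

/-- The morphism given by an extension of the structural morphism to the coproduct of `a` and
`n` copies of an object. -/
noncomputable def graph (n : ℕ) (d : Fiber W a) (ρ : Extension d.str n) :
    d ⟶ (iterFunctor a hW hs (n + 1)).obj d :=
  homMk (d' := mk W (iterIncl a d.pt (n + 1))) (coprod.inr : _ ⟶ iter a d.pt n ⨿ d.pt)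
    (coprod.desc ρ.hom (𝟙 _)) (coprod.inr_desc _ _) (hs.graph ρ.hom) (ρ.extend (𝟙 _)).comp

lemma graph_comp {n : ℕ} {d d' : Fiber W a} (g : d ⟶ d') (ρ : Extension d.str n)
    (ρ' : Extension d'.str n) (h : iterMap a (ret g) n ≫ ρ.hom = ρ'.hom ≫ ret g) :
    graph hW hs n d ρ ≫ (iterFunctor a hW hs (n + 1)).map g = g ≫ graph hW hs n d' ρ' := by
  refine hom_ext ?_ ?_
  · change (coprod.inr : _ ⟶ iter a d.pt n ⨿ d.pt) ≫ coprod.map _ (inc g) = inc g ≫ coprod.inr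
    rw [coprod.inr_map]
  · change coprod.map (iterMap a (ret g) n) (ret g) ≫ coprod.desc ρ.hom (𝟙 _) =
      coprod.desc ρ'.hom (𝟙 _) ≫ ret g
    rw [coprod.desc_comp, coprod.map_desc, h, Category.id_comp, Category.comp_id]

variable {k : Type u} [CommRing k]

/-- The alternating sum of the maps induced by the morphisms `graph`. -/
noncomputable def altGraph (n : ℕ) (X : Fiber W a ⥤ ModuleCat.{u} k) :
    X ⟶ iterFunctor a hW hs (n + 1) ⋙ X where
  app d := Extension.alt d.str n fun ρ => X.map (graph hW hs n d ρ)
  naturality d d' g := by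
    refine (Extension.map_alt (Preadditive.leftComp _ (X.map g)) n _).trans (Eq.trans ?_
      (Extension.map_alt (Preadditive.rightComp _
        ((iterFunctor a hW hs (n + 1) ⋙ X).map g)) n _).symm)
    refine (Extension.alt_congr_of_comm (ret g) (str_ret g) n _ _ fun ρ ρ' h => ?_).symm
    change X.map _ ≫ X.map _ = X.map _ ≫ X.map _
    rw [← X.map_comp, ← X.map_comp, graph_comp hW hs g ρ ρ' h]

/-- The opposite of the part of the alternating sum over the extensions which does not involve the
extension by zero. -/
noncomputable def reduced : ∀ (n : ℕ) (X : Fiber W a ⥤ ModuleCat.{u} k),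
    X ⟶ iterFunctor a hW hs n ⋙ X
  | 0, _ => 0
  | n + 1, X => reduced n X ≫ Functor.whiskerRight (stabilize a hW hs n) X + altGraph hW hs n X

lemma reduced_naturality {X X' : Fiber W a ⥤ ModuleCat.{u} k} (φ : X ⟶ X') : ∀ n,
    reduced hW hs n X ≫ Functor.whiskerLeft (iterFunctor a hW hs n) φ = φ ≫ reduced hW hs n X'
  | 0 => by
    rw [reduced, reduced, zero_comp, comp_zero]
  | n + 1 => by
    have h₁ : altGraph hW hs n X ≫ Functor.whiskerLeft (iterFunctor a hW hs (n + 1)) φ =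
        φ ≫ altGraph hW hs n X' := by
      refine NatTrans.ext (funext fun d => ?_)
      refine (Extension.map_alt (Preadditive.rightComp _ (φ.app _)) n _).trans (Eq.trans ?_
        (Extension.map_alt (Preadditive.leftComp _ (φ.app d)) n _).symm)
      exact congrArg _ (funext fun ρ => φ.naturality _)
    have h₂ : Functor.whiskerRight (stabilize a hW hs n) X ≫
        Functor.whiskerLeft (iterFunctor a hW hs (n + 1)) φ =
          Functor.whiskerLeft (iterFunctor a hW hs n) φ ≫
            Functor.whiskerRight (stabilize a hW hs n) X' :=
      NatTrans.ext (funext fun d => φ.naturality _)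
    rw [reduced, reduced, Preadditive.add_comp, Preadditive.comp_add, h₁, Category.assoc, h₂,
      ← Category.assoc, reduced_naturality φ n, Category.assoc]

/-- Every morphism of the fiber induces the identity on the colimit, so the summand of order `m`
becomes an alternating sum of identities: the identity for `m = 0`, and zero for `m > 0`. The index
starts at `n + 1` because `reduced` is zero for `n = 0`. -/
lemma reduced_comp_ι (X : Fiber W a ⥤ ModuleCat.{u} k) (d : Fiber W a) : ∀ n,
    (reduced hW hs (n + 1) X).app d ≫ colimit.ι X ((iterFunctor a hW hs (n + 1)).obj d) =
      colimit.ι X d := by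
  have h₁ (n : ℕ) : (altGraph hW hs n X).app d ≫
      colimit.ι X ((iterFunctor a hW hs (n + 1)).obj d) =
        Extension.alt d.str n fun _ => colimit.ι X d := by
    refine (Extension.map_alt (Preadditive.rightComp _ (colimit.ι X _)) n _).trans ?_
    exact congrArg _ (funext fun ρ => colimit.w X _)
  have h₂ (n : ℕ) : (reduced hW hs (n + 1) X).app d ≫
      colimit.ι X ((iterFunctor a hW hs (n + 1)).obj d) =
        (reduced hW hs n X).app d ≫ colimit.ι X ((iterFunctor a hW hs n).obj d) +
          Extension.alt d.str n fun _ => colimit.ι X d := by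
    rw [← h₁, ← colimit.w X ((stabilize a hW hs n).app d), reduced, NatTrans.app_add,
      Preadditive.add_comp, NatTrans.comp_app, Category.assoc]
    rfl
  intro n
  induction n with
  | zero =>
    rw [h₂, reduced]
    exact (congrArg (· + _) zero_comp).trans (zero_add _)
  | succ n ih => rw [h₂, ih, Extension.alt_const, add_zero]

end

end Fiber

end Fiber

/-! ### Deviations of polynomial and analytic functors. -/

section Deviation

variable {T : Type u} [SmallCategory T] [HasFiniteCoproducts T] [HasZeroMorphisms T]

/-- The endomorphism which is zero on the copy of `c` of index `m`. -/
noncomputable def kill (a c : T) : ∀ n : ℕ, ℕ → (iter a c n ⟶ iter a c n)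
  | 0, _ => 𝟙 a
  | n + 1, m => if m = n then coprod.map (𝟙 _) 0 else coprod.map (kill a c n m) (𝟙 c)

lemma kill_last (a c : T) (n : ℕ) :
    kill a c (n + 1) n = (coprod.map (𝟙 _) 0 : iter a c n ⨿ c ⟶ iter a c n ⨿ c) :=
  if_pos rfl

lemma kill_of_lt (a c : T) {n m : ℕ} (h : m < n) : kill a c (n + 1) m =
    (coprod.map (kill a c n m) (𝟙 c) : iter a c n ⨿ c ⟶ iter a c n ⨿ c) :=
  if_neg h.ne

/-- After the copy of index `m` is killed, extending by zero or by the identity on it makes no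
difference, and these two choices have opposite signs. -/
lemma alt_kill {a c : T} (f : a ⟶ c) {M : Type*} [AddCommGroup M] : ∀ (n m : ℕ) (_ : m < n)
    (Φ : (iter a c n ⟶ c) → M), Extension.alt f n (fun ρ => Φ (kill a c n m ≫ ρ.hom)) = 0
  | 0, _, h, _ => absurd h (Nat.not_lt_zero _)
  | n + 1, m, h, Φ => by
    rcases (Nat.lt_succ_iff.1 h).eq_or_lt with rfl | h'
    · have e (ρ : Extension f m) (h : c ⟶ c) : kill a c (m + 1) m ≫ (ρ.extend h).hom =
          coprod.desc ρ.hom 0 := by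
        rw [kill_last]
        exact (coprod.map_desc _ _ _ _).trans (by rw [Category.id_comp, zero_comp])
      simp only [Extension.alt, e]
      exact sub_self _
    · have e (ρ : Extension f n) (h : c ⟶ c) : kill a c (n + 1) m ≫ (ρ.extend h).hom =
          coprod.desc (kill a c n m ≫ ρ.hom) h := by
        rw [kill_of_lt a c h']
        exact (coprod.map_desc _ _ _ _).trans (by rw [Category.id_comp])
      simp only [Extension.alt, e]
      rw [alt_kill f n m h' fun ψ => Φ (coprod.desc ψ 0),
        alt_kill f n m h' fun ψ => Φ (coprod.desc ψ (𝟙 c)), sub_zero]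

/-- Split `a * c * ⋯ * c` into `d + 1` blocks: each of the last `d` copies of `c` is one block, and
the rest, which still contains a copy of `c` since `d < n`, is another. For each block, killing a
copy inside it does not affect the other blocks. Only the retraction identity for `g` and `κ` is
needed afterwards. -/
lemma exists_decomposition (a c : T) (d : ℕ) : ∀ n, d < n →
    ∃ (b : Fin (d + 1) → T) (κ : ∀ i, b i ⟶ iter a c n) (g : iter a c n ⟶ ∐ b),
      g ≫ Sigma.desc κ = 𝟙 _ ∧
        ∀ i, ∃ m < n, ∀ j, j ≠ i → κ j ≫ kill a c n m = κ j := by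
  induction d with
  | zero =>
    intro n hn
    -- With one block there is no `j ≠ i`; the first copy serves as `m`, and exists because `0 < n`.
    refine ⟨fun _ => iter a c n, fun _ => 𝟙 _, Sigma.ι (fun _ : Fin 1 => iter a c n) 0,
      Sigma.ι_desc _ _, fun i => ⟨0, hn, fun j hj => absurd ((Fin.fin_one_eq_zero j).trans (Fin.fin_one_eq_zero i).symm) hj⟩⟩
  | succ d ih =>
    rintro (_ | n) hn
    · exact absurd hn (Nat.not_lt_zero _)
    obtain ⟨b, κ, g, hg, hκ⟩ := ih n (Nat.lt_of_succ_lt_succ hn)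
    let b' : Fin (d + 2) → T := fun i => Fin.cases c b i
    let κ' : ∀ i, b' i ⟶ iter a c n ⨿ c :=
      fun i => Fin.cases (motive := fun i => b' i ⟶ iter a c n ⨿ c) coprod.inr
        (fun i => κ i ≫ coprod.inl) i
    let s : ∐ b ⟶ ∐ b' := Sigma.desc fun i => Sigma.ι b' i.succ
    have hs : s ≫ Sigma.desc κ' = Sigma.desc κ ≫ coprod.inl := by
      refine Sigma.hom_ext _ _ fun i => ?_
      have h₁ : Sigma.ι b i ≫ s = Sigma.ι b' i.succ := Sigma.ι_desc _ _
      have h₂ : Sigma.ι b' i.succ ≫ Sigma.desc κ' = κ i ≫ coprod.inl := Sigma.ι_desc κ' i.succ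
      rw [Sigma.ι_desc_assoc, reassoc_of% h₁]
      exact h₂
    let z : c ⟶ ∐ b' := Sigma.ι b' 0
    have hz : z ≫ Sigma.desc κ' = coprod.inr := Sigma.ι_desc κ' 0
    refine ⟨b', κ', coprod.desc (g ≫ s) z, ?_, fun i => ?_⟩
    · change coprod.desc (g ≫ s) z ≫ Sigma.desc κ' = 𝟙 (iter a c n ⨿ c)
      refine coprod.hom_ext ?_ ?_
      · rw [coprod.inl_desc_assoc, Category.assoc, hs, reassoc_of% hg, Category.comp_id]
      · rw [coprod.inr_desc_assoc, Category.comp_id, hz]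
    · induction i using Fin.cases with
      | zero =>
        refine ⟨n, Nat.lt_succ_self n, fun j hj => ?_⟩
        obtain ⟨j, rfl⟩ := Fin.exists_succ_eq.2 hj
        rw [kill_last]
        change (κ j ≫ coprod.inl) ≫ coprod.map (𝟙 _) 0 = κ j ≫ coprod.inl
        rw [Category.assoc, coprod.inl_map, Category.id_comp]
      | succ i =>
        obtain ⟨m, hm, h⟩ := hκ i
        refine ⟨m, hm.trans (Nat.lt_succ_self n), fun j hj => ?_⟩
        rw [kill_of_lt a c hm]
        induction j using Fin.cases with
        | zero =>
          change coprod.inr ≫ coprod.map _ (𝟙 c) = coprod.inr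
          rw [coprod.inr_map, Category.id_comp]
        | succ j =>
          change (κ j ≫ coprod.inl) ≫ coprod.map _ (𝟙 c) = κ j ≫ coprod.inl
          rw [Category.assoc, coprod.inl_map, ← Category.assoc,
            h j fun hji => hj (congrArg Fin.succ hji)]

variable {k : Type u} [CommRing k] {F : Tᵒᵖ ⥤ ModuleCat.{u} k}

/-- The deviation of order `n` of an element of `F c` along `f : a ⟶ c`. -/
noncomputable def deviation (F : Tᵒᵖ ⥤ ModuleCat.{u} k) {a c : T} (f : a ⟶ c) (n : ℕ)
    (y : F.obj (op c)) : F.obj (op (iter a c n)) :=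
  Extension.alt f n fun ρ => F.map ρ.hom.op y

/-- On the complement of a block, the restriction of `x` factors through the restriction of `x`
along a `kill`, hence vanishes. So `x`, viewed on the coproduct of the `d + 1` blocks, lies in the
cross effect of order `d + 1`. -/
lemma IsPolynomialOfDegreeLE.eq_zero {d : ℕ} (hF : IsPolynomialOfDegreeLE F d) {a c : T} {n : ℕ}
    (hn : d < n) (x : F.obj (op (iter a c n)))
    (hx : ∀ m < n, F.map (kill a c n m).op x = 0) : x = 0 := by
  obtain ⟨b, κ, g, hg, hκ⟩ := exists_decomposition a c d n hn
  have h : F.map (Sigma.desc κ).op x = 0 := by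
    refine hF b _ fun i => ?_
    obtain ⟨m, hm, h⟩ := hκ i
    have e : Sigma.desc (fun j : {j : Fin (d + 1) // j ≠ i} => Sigma.ι b j.1) ≫ Sigma.desc κ =
        Sigma.desc (fun j : {j : Fin (d + 1) // j ≠ i} => κ j.1) ≫ kill a c n m := by
      refine Sigma.hom_ext _ _ fun j => ?_
      rw [Sigma.ι_desc_assoc, Sigma.ι_desc, Sigma.ι_desc_assoc, h j.1 j.2]
    rw [← ConcreteCategory.comp_apply, ← F.map_comp, ← op_comp, e, op_comp, F.map_comp,
      ConcreteCategory.comp_apply, hx m hm, map_zero]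
  have h' : F.map g.op (F.map (Sigma.desc κ).op x) = x := by
    rw [← ConcreteCategory.comp_apply, ← F.map_comp, ← op_comp, hg, op_id, F.map_id]
    rfl
  rw [← h', h, map_zero]

lemma IsPolynomialOfDegreeLE.deviation_eq_zero {d : ℕ} (hF : IsPolynomialOfDegreeLE F d) {a c : T}
    (f : a ⟶ c) {n : ℕ} (hn : d < n) (y : F.obj (op c)) : deviation F f n y = 0 := by
  refine hF.eq_zero hn _ fun m hm => ?_
  refine (Extension.map_alt (F.map (kill a c n m).op).hom.toAddMonoidHom n _).trans
    (Eq.trans ?_ (alt_kill f n m hm fun ψ => F.map ψ.op y))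
  refine congrArg _ (funext fun ρ => ?_)
  change F.map _ (F.map _ y) = _
  rw [← ConcreteCategory.comp_apply, ← F.map_comp, ← op_comp]

lemma deviation_add {a c : T} (f : a ⟶ c) (n : ℕ) (y y' : F.obj (op c)) :
    deviation F f n (y + y') = deviation F f n y + deviation F f n y' := by
  simp only [deviation, map_add, Extension.alt_add]

lemma deviation_smul {a c : T} (f : a ⟶ c) (n : ℕ) (r : k) (y : F.obj (op c)) :
    deviation F f n (r • y) = r • deviation F f n y := by
  refine Eq.trans ?_ (Extension.map_alt (DistribSMul.toAddMonoidHom _ r) n _).symm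
  simp only [deviation, map_smul]
  rfl

lemma deviation_app {F' : Tᵒᵖ ⥤ ModuleCat.{u} k} (φ : F' ⟶ F) {a c : T} (f : a ⟶ c) (n : ℕ)
    (y : F'.obj (op c)) :
    deviation F f n (φ.app (op c) y) = φ.app _ (deviation F' f n y) := by
  refine Eq.trans ?_ (Extension.map_alt (φ.app _).hom.toAddMonoidHom n _).symm
  exact congrArg (Extension.alt f n) (funext fun ρ =>
    (NatTrans.naturality_apply φ ρ.hom.op y).symm)

/-- The elements with this property form a submodule, because deviations are linear in `y`. It
contains the image of every polynomial functor of the diagram, with a bound that depends on the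
functor, and these images generate since colimits of functors are computed objectwise. -/
lemma IsAnalytic.eventually_deviation_eq_zero (hF : IsAnalytic F) {a c : T} (f : a ⟶ c)
    (y : F.obj (op c)) : ∀ᶠ n in Filter.atTop, deviation F f n y = 0 := by
  obtain ⟨J, _, D, ι, hD, ⟨hι⟩⟩ := hF
  let S : Submodule k (F.obj (op c)) :=
    { carrier := {y | ∀ᶠ n in Filter.atTop, deviation F f n y = 0}
      add_mem' := fun h h' => by
        filter_upwards [h, h'] with n h₁ h₂
        rw [deviation_add, h₁, h₂, add_zero]
      zero_mem' := Filter.Eventually.of_forall fun n => by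
        have := deviation_smul (F := F) f n 0 0
        rwa [zero_smul, zero_smul] at this
      smul_mem' := fun r y h => by
        filter_upwards [h] with n h₁
        rw [deviation_smul, h₁, smul_zero] }
  have hS (j : J) (x : (D.obj j).obj (op c)) : (ι.app j).app (op c) x ∈ S := by
    obtain ⟨d, hd⟩ := hD j
    filter_upwards [Filter.eventually_gt_atTop d] with n hn
    rw [deviation_app, hd.deviation_eq_zero f hn, map_zero]
  have hc : IsColimit (((evaluation _ _).obj (op c)).mapCocone (Cocone.mk F ι)) :=
    isColimitOfPreserves _ hι
  -- The quotient by `S` receives the zero map from each term of the colimit, so the quotient map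
  -- itself is zero.
  have h : ModuleCat.ofHom S.mkQ = 0 := hc.hom_ext fun j => by
    refine ConcreteCategory.hom_ext _ _ fun x => ?_
    exact (Submodule.Quotient.mk_eq_zero S).2 (hS j x)
  exact (Submodule.Quotient.mk_eq_zero S).1 (ConcreteCategory.congr_hom h y)

end Deviation

/-! ### The transformation `reduced` on the restriction of a contravariant functor. -/

namespace Fiber

variable {T : Type u} [SmallCategory T] {W : MorphismProperty (SCat T)} [W.IsMultiplicative]
  {k : Type u} [CommRing k] (F : Tᵒᵖ ⥤ ModuleCat.{u} k)

/-- The restriction of a contravariant functor on `T` to `Fiber W a`. -/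
abbrev restrict (W : MorphismProperty (SCat T)) [W.IsMultiplicative]
    (F : Tᵒᵖ ⥤ ModuleCat.{u} k) (a : T) : Fiber W a ⥤ ModuleCat.{u} k :=
  CostructuredArrow.proj (restrictedToOp W) (op a) ⋙ restrictedToOp W ⋙ F

/-- The map `F c ⟶ F a` induced by the structural morphism. -/
def restrictTo (W : MorphismProperty (SCat T)) [W.IsMultiplicative] (a : T) :
    restrict W F a ⟶ (Functor.const _).obj (mk W (𝟙 a)) ⋙ restrict W F a where
  app d := F.map d.hom
  naturality d d' g := by
    change F.map ((restrictedToOp W).map g.left) ≫ F.map d'.hom = F.map d.hom ≫ F.map (𝟙 _)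
    rw [← F.map_comp, CostructuredArrow.w, F.map_id, Category.comp_id]

variable [HasFiniteCoproducts T] [HasZeroMorphisms T] (hW : SCat.canonical T ≤ W)
  (hs : SCat.IsStable W)

/-- The components of `reduced` for the restriction of a contravariant functor on `T`. -/
noncomputable def reducedApp {a : T} (d : Fiber W a) (n : ℕ) :
    F.obj (op d.pt) ⟶ F.obj (op (iter a d.pt n)) :=
  (reduced hW hs n (restrict W F a)).app d

/-- The value of the restriction of a contravariant functor on `T` at `unit`. -/
noncomputable def unitApp {a : T} (d : Fiber W a) (n : ℕ) :
    F.obj (op a) ⟶ F.obj (op (iter a d.pt n)) :=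
  (restrict W F a).map ((unit a hW hs n).app d)

lemma reducedApp_succ {a : T} (d : Fiber W a) (n : ℕ) : reducedApp F hW hs d (n + 1) =
    reducedApp F hW hs d n ≫
      F.map (iterDrop a d.pt n).op +
      Extension.alt d.str n (fun ρ => F.map (ρ.extend (𝟙 _)).hom.op) := rfl

lemma unitApp_succ {a : T} (d : Fiber W a) (n : ℕ) : unitApp F hW hs d (n + 1) =
    unitApp F hW hs d n ≫
      F.map (iterDrop a d.pt n).op :=
  (restrict W F a).map_comp _ _

/-- In the deviation of order `n + 1`, the terms which are zero on the last copy give the deviation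
of order `n` pulled back along `iterDrop`; the others, apart from their sign, are the summand added
to `reduced`. The formula then follows by telescoping, starting from the deviation of order zero,
which is `F.map d.hom y`. -/
lemma reducedApp_apply {a : T} (d : Fiber W a) (y : F.obj (op d.pt)) (n : ℕ) :
    reducedApp F hW hs d n y =
      unitApp F hW hs d n (F.map d.hom y) - deviation F d.str n y := by
  induction n with
  | zero =>
    have h : unitApp F hW hs d 0 = 𝟙 (F.obj (op a)) := (restrict W F a).map_id _
    rw [h]
    exact (sub_self _).symm
  | succ n ih =>
    let s : F.obj (op (iter a d.pt n)) ⟶ F.obj (op (iter a d.pt (n + 1))) :=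
      F.map (iterDrop a d.pt n).op
    have h₁ : (Extension.alt d.str n (fun ρ => F.map (ρ.extend (𝟙 _)).hom.op)) y =
        Extension.alt d.str n fun ρ => F.map (ρ.extend (𝟙 _)).hom.op y :=
      Extension.map_alt ((AddMonoidHom.eval y).comp
        (AddMonoidHom.mk' (fun f : F.obj (op d.pt) ⟶ F.obj (op (iter a d.pt (n + 1))) =>
          f.hom.toAddMonoidHom) fun _ _ => rfl)) n _
    have h₂ : s (deviation F d.str n y) =
        Extension.alt d.str n fun ρ => F.map (ρ.extend 0).hom.op y := by
      refine (Extension.map_alt s.hom.toAddMonoidHom n _).trans ?_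
      refine congrArg (Extension.alt d.str n) (funext fun ρ => ?_)
      change F.map _ (F.map _ y) = _
      rw [← ConcreteCategory.comp_apply, ← F.map_comp, ← op_comp, ρ.iterDrop_comp]
    rw [reducedApp_succ, unitApp_succ]
    change s (reducedApp F hW hs d n y) + (Extension.alt d.str n
      (fun ρ => F.map (ρ.extend (𝟙 _)).hom.op)) y = s (unitApp F hW hs d n (F.map d.hom y)) -
        ((Extension.alt d.str n fun ρ => F.map (ρ.extend 0).hom.op y) -
          Extension.alt d.str n fun ρ => F.map (ρ.extend (𝟙 _)).hom.op y)
    rw [ih, h₁, map_sub, h₂]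
    abel

end Fiber

/-! ### Left Kan extensions of complexes and their values as colimits. -/

section KanExtension

variable {k : Type u} [CommRing k] {C B : Type u} [SmallCategory C] [SmallCategory B] (β : C ⥤ B)

instance lan_additive : (β.lan : (C ⥤ ModuleCat.{u} k) ⥤ (B ⥤ ModuleCat.{u} k)).Additive :=
  have : ((Functor.whiskeringLeft C B (ModuleCat.{u} k)).obj β).Additive := pullback_additive β
  (β.lanAdjunction (ModuleCat.{u} k)).left_adjoint_additive

/-- The right adjoint, restriction along `β`, is exact and so preserves epimorphisms. -/
instance lan_preservesProjectiveObjects :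
    (β.lan : (C ⥤ ModuleCat.{u} k) ⥤ (B ⥤ ModuleCat.{u} k)).PreservesProjectiveObjects where
  projective_obj {P} hP := by
    have : ((Functor.whiskeringLeft C B (ModuleCat.{u} k)).obj β).PreservesEpimorphisms :=
      Functor.preservesEpimorphisms_of_map_exact (pullback k β) fun S hS => hS.map _
    exact (β.lanAdjunction (ModuleCat.{u} k)).map_projective P hP

/-- The augmentation of the left Kan extension of a resolution. -/
noncomputable def lanAugmentation {K : ChainComplex (C ⥤ ModuleCat.{u} k) ℕ}
    {F : B ⥤ ModuleCat.{u} k} (η : K.X 0 ⟶ β ⋙ F) : β.lan.obj (K.X 0) ⟶ F :=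
  ((β.lanAdjunction (ModuleCat.{u} k)).homEquiv _ _).symm η

lemma unit_lanAugmentation {K : ChainComplex (C ⥤ ModuleCat.{u} k) ℕ}
    {F : B ⥤ ModuleCat.{u} k} (η : K.X 0 ⟶ β ⋙ F) (c : C) :
    (β.lanUnit.app (K.X 0)).app c ≫ (lanAugmentation β η).app (β.obj c) = η.app c := by
  have h := ((β.lanAdjunction (ModuleCat.{u} k)).homEquiv _ _).apply_symm_apply η
  rw [Adjunction.homEquiv_unit, Functor.lanAdjunction_unit] at h
  exact NatTrans.congr_app h c

lemma unit_map_lanAugmentation {K : ChainComplex (C ⥤ ModuleCat.{u} k) ℕ}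
    {F : B ⥤ ModuleCat.{u} k} (η : K.X 0 ⟶ β ⋙ F) {c : C} {t : B} (f : β.obj c ⟶ t) :
    ((β.lanUnit.app (K.X 0)).app c ≫ (β.lan.obj (K.X 0)).map f) ≫ (lanAugmentation β η).app t =
      η.app c ≫ F.map f :=
  (Category.assoc _ _ _).trans ((congrArg _ ((lanAugmentation β η).naturality f)).trans
    ((Category.assoc _ _ _).symm.trans (congrArg (· ≫ F.map f) (unit_lanAugmentation β η c))))

/-- The left Kan extension of a complex is a resolution if the complexes of colimits which compute
its values are. -/
lemma isResolution_lan {K : ChainComplex (C ⥤ ModuleCat.{u} k) ℕ} {F : B ⥤ ModuleCat.{u} k}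
    (η : K.X 0 ⟶ β ⋙ F)
    (a : ∀ t, colimit (CostructuredArrow.proj β t ⋙ K.X 0) ⟶ F.obj t)
    (ha : ∀ t d, colimit.ι (CostructuredArrow.proj β t ⋙ K.X 0) d ≫ a t =
      η.app d.left ≫ F.map d.hom)
    (h : ∀ t, IsResolution ((colim.mapHomologicalComplex (ComplexShape.down ℕ)).obj
      (((pullback k (CostructuredArrow.proj β t)).mapHomologicalComplex _).obj K)) (a t)) :
    IsResolution ((β.lan.mapHomologicalComplex (ComplexShape.down ℕ)).obj K)
      (lanAugmentation β η) := by
  refine IsResolution.of_evaluation fun t => ?_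
  let e := lanEvaluationIsoColim (ModuleCat.{u} k) β t
  -- The pointwise formula for Kan extensions, applied in each degree, identifies the value at `t`
  -- with a complex of colimits.
  let e' : (colim.mapHomologicalComplex (ComplexShape.down ℕ)).obj
      (((pullback k (CostructuredArrow.proj β t)).mapHomologicalComplex _).obj K) ≅
      (((evaluation B (ModuleCat.{u} k)).obj t).mapHomologicalComplex _).obj
        ((β.lan.mapHomologicalComplex (ComplexShape.down ℕ)).obj K) :=
    HomologicalComplex.Hom.isoOfComponents (fun n => (e.app (K.X n)).symm)
      fun i j _ => (e.inv.naturality (K.d i j)).symm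
  refine (h t).of_iso e' ?_
  refine colimit.hom_ext fun d => ?_
  have h₁ : colimit.ι (CostructuredArrow.proj β t ⋙ K.X 0) d ≫ e.inv.app (K.X 0) =
      (β.lanUnit.app (K.X 0)).app d.left ≫ (β.lan.obj (K.X 0)).map d.hom :=
    IsColimit.comp_coconePointUniqueUpToIso_inv
      (Functor.isPointwiseLeftKanExtensionLeftKanExtensionUnit β (K.X 0) t)
      (colimit.isColimit (CostructuredArrow.proj β t ⋙ K.X 0)) d
  refine Eq.trans ?_ (ha t d).symm
  exact (Category.assoc _ _ _).symm.trans ((congrArg (· ≫ (lanAugmentation β η).app t) h₁).trans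
    (unit_map_lanAugmentation β η d.hom))

end KanExtension

/-! ### Exactness of the Kan extension of a resolution, for an analytic functor. -/

section Main

variable {T : Type u} [SmallCategory T] {W : MorphismProperty (SCat T)} [W.IsMultiplicative]
  {k : Type u} [CommRing k] {F : Tᵒᵖ ⥤ ModuleCat.{u} k}
  [HasFiniteCoproducts T] [HasZeroMorphisms T]

/-- The left Kan extension along `β` of a projective resolution of `β^* F` is a resolution
of `F`. -/
theorem isResolution_lan_of_isAnalytic (hW : SCat.canonical T ≤ W)
    (hs : SCat.IsStable W) (hF : IsAnalytic F)
    (P : ProjectiveResolution (restrictedToOp W ⋙ F)) :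
    IsResolution (((restrictedToOp W).lan.mapHomologicalComplex (ComplexShape.down ℕ)).obj
      P.complex) (lanAugmentation (restrictedToOp W) (P.π.f 0)) := by
  let E (t : Tᵒᵖ) := pullback k (CostructuredArrow.proj (restrictedToOp W) t)
  have hE (t : Tᵒᵖ) (n : ℕ) :
      Projective ((((E t).mapHomologicalComplex (ComplexShape.down ℕ)).obj P.complex).X n) :=
    (E t).projective_obj_of_projective (P.projective n)
  have hR (t : Tᵒᵖ) := (isResolution_of_projectiveResolution P).map (E t)
  let η (t : Tᵒᵖ) : CostructuredArrow.proj (restrictedToOp W) t ⋙ P.complex.X 0 ⟶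
    Fiber.restrict W F t.unop := (E t).map (P.π.f 0)
  refine isResolution_lan _ _ (fun t => colimitDesc _ (η t ≫ Fiber.restrictTo F W t.unop))
    (fun t d => ι_colimitDesc _ _ d) fun t => ?_
  -- The base point is the identity of `t.unop`. All indices are shifted by one, as `reduced` of
  -- index zero vanishes and does not induce the identity on colimits.
  refine isResolution_colim (hR t) (Fiber.mk W (𝟙 t.unop)) (Fiber.restrictTo F W t.unop) ?_
    (fun n => Fiber.iterFunctor t.unop hW hs (n + 1)) (fun n => Fiber.unit t.unop hW hs (n + 1))
    (fun n X => Fiber.reduced hW hs (n + 1) X)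
    (fun n {_ _} f => Fiber.reduced_naturality hW hs f (n + 1))
    (fun n X d => Fiber.reduced_comp_ι hW hs X d n) fun d y => ?_
  · exact F.map_id _
  -- For large `n` the deviation of `y` vanishes, and `reduced` then factors through the value at
  -- the base point.
  · filter_upwards [(Filter.tendsto_add_atTop_nat 1).eventually
      (hF.eventually_deviation_eq_zero (Fiber.str d) y)] with n hn
    have h := Fiber.reducedApp_apply F hW hs d y (n + 1)
    rw [hn, sub_zero] at h
    exact h

end Main

/-! ### Tensor products along a left Kan extension. -/

section Adjunction

open MonoidalCategory

variable {k : Type u} [CommRing k] {T : Type u} [SmallCategory T] (G : T ⥤ ModuleCat.{u} k)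
  {N : ModuleCat.{u} k}

variable (N) in
/-- The contravariant functor `Hom(G, N)`. -/
noncomputable def homInto : Tᵒᵖ ⥤ ModuleCat.{u} k := G.op ⋙ MonoidalClosed.internalHom.flip.obj N

section

variable {G} {Z : Tᵒᵖ ⥤ ModuleCat.{u} k}

/-- The component `G t ⊗ Z t ⟶ N` of a morphism `Z ⊗_T G ⟶ N`. -/
noncomputable def tensorComponent (φ : ((tensorOver k T).obj Z).obj G ⟶ N) (t : Tᵒᵖ) :
    G.obj t.unop ⊗ Z.obj t ⟶ N :=
  (β_ (G.obj t.unop) (Z.obj t)).hom ≫ tensorι Z G t.unop ≫ φ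

lemma tensorComponent_condition (φ : ((tensorOver k T).obj Z).obj G ⟶ N) {t t' : Tᵒᵖ}
    (f : t ⟶ t') :
    G.obj t'.unop ◁ Z.map f ≫ tensorComponent φ t' =
      G.map f.unop ▷ Z.obj t ≫ tensorComponent φ t := by
  have h : Z.map f ▷ G.obj t'.unop ≫ tensorι Z G t'.unop =
      Z.obj t ◁ G.map f.unop ≫ tensorι Z G t.unop := tensorι_condition Z G f.unop
  rw [tensorComponent, tensorComponent, BraidedCategory.braiding_naturality_right_assoc,
    BraidedCategory.braiding_naturality_left_assoc, reassoc_of% h]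

/-- The morphism `Z ⟶ Hom(G, N)` which corresponds to a morphism `Z ⊗_T G ⟶ N`. -/
noncomputable def tensorCurry (φ : ((tensorOver k T).obj Z).obj G ⟶ N) : Z ⟶ homInto G N where
  app t := MonoidalClosed.curry (tensorComponent φ t)
  naturality _ _ f := (MonoidalClosed.curry_natural_left _ _).symm.trans
    ((congrArg MonoidalClosed.curry (tensorComponent_condition φ f)).trans
      (MonoidalClosed.curry_pre_app _ _).symm)

lemma tensorCurry_injective :
    Function.Injective (tensorCurry : (((tensorOver k T).obj Z).obj G ⟶ N) → _) := by
  intro φ ψ h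
  refine tensorOver_hom_ext fun t => ?_
  have h₁ : tensorComponent φ (op t) = tensorComponent ψ (op t) :=
    MonoidalClosed.curry_injective (NatTrans.congr_app h (op t))
  exact (cancel_epi (β_ (G.obj t) (Z.obj (op t))).hom).1 h₁

/-- The morphism `Z ⊗_T G ⟶ N` which corresponds to a morphism `Z ⟶ Hom(G, N)`. -/
noncomputable def tensorUncurry (φ : Z ⟶ homInto G N) : ((tensorOver k T).obj Z).obj G ⟶ N :=
  tensorDesc Z G (fun t => (β_ (Z.obj (op t)) (G.obj t)).hom ≫
    MonoidalClosed.uncurry (A := G.obj t) (φ.app (op t))) fun t t' f => by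
      have h : G.obj t ◁ Z.map f.op ≫ MonoidalClosed.uncurry (A := G.obj t) (φ.app (op t)) =
          G.map f ▷ Z.obj (op t') ≫ MonoidalClosed.uncurry (A := G.obj t') (φ.app (op t')) :=
        (MonoidalClosed.uncurry_natural_left _ _).symm.trans
          ((congrArg (MonoidalClosed.uncurry (A := G.obj t)) (φ.naturality f.op)).trans
            (MonoidalClosed.uncurry_pre_app _ _ _))
      exact (BraidedCategory.braiding_naturality_left_assoc _ _ _).trans
        ((congrArg _ h).trans (BraidedCategory.braiding_naturality_right_assoc _ _ _).symm)

lemma tensorCurry_tensorUncurry (φ : Z ⟶ homInto G N) : tensorCurry (tensorUncurry φ) = φ := by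
  refine NatTrans.ext (funext fun t => ?_)
  have h : tensorComponent (tensorUncurry φ) t =
      MonoidalClosed.uncurry (A := G.obj t.unop) (φ.app t) :=
    (congrArg _ (ι_tensorDesc _ _ _ _ t.unop)).trans
      (SymmetricCategory.symmetry_assoc (G.obj t.unop) (Z.obj t) _)
  exact (congrArg MonoidalClosed.curry h).trans (MonoidalClosed.curry_uncurry _)

end

variable {C : Type u} [SmallCategory C] (β : C ⥤ Tᵒᵖ) (X : C ⥤ ModuleCat.{u} k)

/-- The canonical map `β^* G ⊗_C X ⟶ β_! X ⊗_T G`. -/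
noncomputable def tensorLan :
    ((tensorOver k C).obj (β.leftOp ⋙ G)).obj X ⟶ ((tensorOver k T).obj (β.lan.obj X)).obj G :=
  ((tensorOver k C).obj (β.leftOp ⋙ G)).map (β.lanUnit.app X) ≫
    tensorComparisonApp β G (β.lan.obj X)

variable {X} in
/-- The morphism `X ⟶ β^* Hom(G, N)` which corresponds to a morphism `β^* G ⊗_C X ⟶ N`. -/
noncomputable def tensorPullbackCurry
    (φ : ((tensorOver k C).obj (β.leftOp ⋙ G)).obj X ⟶ N) : X ⟶ β ⋙ homInto G N where
  app c := MonoidalClosed.curry (A := G.obj (β.obj c).unop) (tensorι (β.leftOp ⋙ G) X c ≫ φ)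
  naturality {c d} f := by
    have h : G.map (β.map f).unop ▷ X.obj c ≫ tensorι (β.leftOp ⋙ G) X c ≫ φ =
        G.obj (β.obj d).unop ◁ X.map f ≫ tensorι (β.leftOp ⋙ G) X d ≫ φ :=
      (Category.assoc _ _ _).symm.trans ((congrArg (· ≫ φ)
        (tensorι_condition (β.leftOp ⋙ G) X f)).trans (Category.assoc _ _ _))
    exact (MonoidalClosed.curry_natural_left _ _).symm.trans
      ((congrArg MonoidalClosed.curry h.symm).trans (MonoidalClosed.curry_pre_app _ _).symm)

lemma tensorPullbackCurry_injective :
    Function.Injective (tensorPullbackCurry (N := N) (X := X) G β) := by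
  intro φ ψ h
  refine tensorOver_hom_ext fun c => ?_
  exact MonoidalClosed.curry_injective (A := G.obj (β.obj c).unop) (NatTrans.congr_app h c)

/-- Precomposition with `tensorLan` corresponds, through the tensor-hom adjunctions over `C` and
over `T`, to the bijection of the Kan extension adjunction. -/
lemma tensorPullbackCurry_tensorLan (φ : ((tensorOver k T).obj (β.lan.obj X)).obj G ⟶ N) :
    tensorPullbackCurry G β (tensorLan G β X ≫ φ) =
      β.lanUnit.app X ≫ (pullback k β).map (tensorCurry φ) := by
  refine NatTrans.ext (funext fun c => ?_)
  refine Eq.trans (congrArg MonoidalClosed.curry ?_)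
    (MonoidalClosed.curry_natural_left (A := G.obj (β.obj c).unop)
      ((β.lanUnit.app X).app c) (tensorComponent φ (β.obj c)))
  have h := tensorι_map_right (β.leftOp ⋙ G) (β.lanUnit.app X) c
  have h' := ι_tensorComparisonApp β G (β.lan.obj X) c
  rw [tensorLan, Category.assoc, reassoc_of% h]
  exact congrArg _ ((Category.assoc _ _ _).symm.trans ((congrArg (· ≫ φ) h').trans
    (Category.assoc _ _ _)))

/-- Both sides represent the functor of `N` given by the morphisms from `X` to the restriction of
`Hom(G, N)` along `β`. -/
instance isIso_tensorLan : IsIso (tensorLan G β X) := by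
  let e (Z : Tᵒᵖ ⥤ ModuleCat.{u} k) := (β.lanAdjunction (ModuleCat.{u} k)).homEquiv X Z
  have he (Z : Tᵒᵖ ⥤ ModuleCat.{u} k) (f : β.lan.obj X ⟶ Z) :
      e Z f = β.lanUnit.app X ≫ (pullback k β).map f := by
    simp only [e, Adjunction.homEquiv_unit, Functor.lanAdjunction_unit]
  have hepi : Epi (tensorLan G β X) := ⟨fun {N} φ ψ h => tensorCurry_injective <|
    (e (homInto G N)).injective <| by
      rw [he, he, ← tensorPullbackCurry_tensorLan, h, tensorPullbackCurry_tensorLan]⟩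
  -- The retraction is the transpose of the identity of the source, for `N` equal to that source.
  have hmono : IsSplitMono (tensorLan G β X) := ⟨⟨⟨tensorUncurry ((e _).symm
    (tensorPullbackCurry G β (𝟙 _))), tensorPullbackCurry_injective _ _ _ (by
      rw [tensorPullbackCurry_tensorLan, tensorCurry_tensorUncurry, ← he,
        Equiv.apply_symm_apply])⟩⟩⟩
  exact isIso_of_epi_of_isSplitMono _

end Adjunction

/-! ### A criterion for the comparison of derived functors to be an isomorphism. -/

section DerivedComparison

universe v₁ v₂ v₃ u₁ u₂ u₃

variable {A : Type u₁} [Category.{v₁} A] [Abelian A]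
  {B : Type u₂} [Category.{v₂} B] [Abelian B]
  {M : Type u₃} [Category.{v₃} M] [Abelian M]

/-- A lift of the identity of `Z` is homotopic to the canonical homotopy equivalence between the two
resolutions, and an additive functor preserves homotopy equivalences. -/
lemma isIso_homologyMap_of_projectiveResolution (S : A ⥤ M) [S.Additive] {Z : A}
    (P Q : ProjectiveResolution Z) (f : P.complex ⟶ Q.complex)
    (hf : f.f 0 ≫ Q.π.f 0 = P.π.f 0) (n : ℕ) :
    IsIso (HomologicalComplex.homologyMap
      ((S.mapHomologicalComplex (ComplexShape.down ℕ)).map f) n) := by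
  have hf' : f ≫ Q.π = P.π := by
    refine HomologicalComplex.to_single_hom_ext ?_
    exact hf
  let e : Homotopy (P.homotopyEquiv Q).hom f :=
    ProjectiveResolution.liftHomotopy (𝟙 Z) _ _ (by simp) (by simp [hf'])
  exact ((S.mapHomotopyEquiv ((P.homotopyEquiv Q).copy e)).toHomologyIso n).isIso_hom

/-- Let `L` be left adjoint to the exact functor `E`. If the derived functors of `L` vanish on
`E Z`, if `L (E Z) = Z` and if `α` induces an isomorphism from `S` to the composite of `L` and
`S'`, then `derivedComparison` is an isomorphism at `Z`. -/
theorem isIso_derivedComparison [EnoughProjectives A] [EnoughProjectives B] {E : A ⥤ B}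
    [E.Additive] [E.PreservesHomology] {L : B ⥤ A} [L.Additive] [L.PreservesProjectiveObjects] (adj : L ⊣ E)
    (S : B ⥤ M) [S.Additive] (S' : A ⥤ M) [S'.Additive] (α : E ⋙ S ⟶ S')
    (hα : ∀ Y, IsIso (S.map (adj.unit.app Y) ≫ α.app (L.obj Y))) (n : ℕ) (Z : A)
    (hZ : IsResolution ((L.mapHomologicalComplex (ComplexShape.down ℕ)).obj
      (projectiveResolution (E.obj Z)).complex)
      ((adj.homEquiv _ _).symm ((projectiveResolution (E.obj Z)).π.f 0))) :
    IsIso (derivedComparison E S S' α n Z) := by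
  let P := projectiveResolution (E.obj Z)
  let Q := projectiveResolution Z
  let R := hZ.projectiveResolution fun n => L.projective_obj_of_projective (P.projective n)
  let θ := liftResolution E P Q
  -- The adjoint of the lift `θ` is again a lift of an identity, now between two projective
  -- resolutions of `Z`.
  let θ' : R.complex ⟶ Q.complex :=
    { f := fun n => (adj.homEquiv _ _).symm (θ.f n)
      comm' := fun i j _ => by
        have h := congrArg (adj.homEquiv _ _).symm (θ.comm i j)
        exact (adj.homEquiv_naturality_right_symm _ _).symm.trans
          (h.trans (adj.homEquiv_naturality_left_symm _ _)) }
  have hθ' : θ'.f 0 ≫ Q.π.f 0 = R.π.f 0 :=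
    (adj.homEquiv_naturality_right_symm _ _).symm.trans
      ((congrArg (adj.homEquiv _ _).symm (liftResolution_comm E P Q)).trans
        (hZ.projectiveResolution_π_f_zero _).symm)
  have hunit (n : ℕ) : adj.unit.app (P.complex.X n) ≫ E.map (θ'.f n) = θ.f n :=
    (adj.homEquiv_unit _ _ _).symm.trans ((adj.homEquiv _ _).apply_symm_apply _)
  let κ : (S.mapHomologicalComplex (ComplexShape.down ℕ)).obj P.complex ≅
      (S'.mapHomologicalComplex (ComplexShape.down ℕ)).obj R.complex :=
    HomologicalComplex.Hom.isoOfComponents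
      (fun n => @asIso _ _ _ _ (S.map (adj.unit.app (P.complex.X n)) ≫
        α.app (L.obj (P.complex.X n))) (hα _)) fun i j _ => by
        have h := (Category.assoc _ _ _).trans
          (congrArg (S.map (adj.unit.app (P.complex.X i)) ≫ ·)
            (α.naturality (L.map (P.complex.d i j))).symm)
        have h' := (S.map_comp _ _).symm.trans ((congrArg S.map
          (adj.unit.naturality (P.complex.d i j)).symm).trans (S.map_comp _ _))
        exact h.trans ((Category.assoc _ _ _).symm.trans
          ((congrArg (· ≫ α.app (L.obj (P.complex.X j))) h').trans (Category.assoc _ _ _)))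
  -- The chain map that defines the comparison thus factors as an isomorphism of complexes followed
  -- by the image under `S'` of a homotopy equivalence.
  have hκ : (S.mapHomologicalComplex (ComplexShape.down ℕ)).map θ ≫
      (NatTrans.mapHomologicalComplex α (ComplexShape.down ℕ)).app Q.complex =
      κ.hom ≫ (S'.mapHomologicalComplex (ComplexShape.down ℕ)).map θ' := by
    refine HomologicalComplex.Hom.ext (funext fun n => ?_)
    have h := (Category.assoc _ _ _).trans
      (congrArg (S.map (adj.unit.app (P.complex.X n)) ≫ ·) (α.naturality (θ'.f n)).symm)
    have h' := (S.map_comp _ _).symm.trans (congrArg S.map (hunit n))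
    exact (h.trans ((Category.assoc _ _ _).symm.trans
      (congrArg (· ≫ α.app (Q.complex.X n)) h'))).symm
  have := isIso_homologyMap_of_projectiveResolution S' R Q θ' hθ' n
  have hiso : IsIso ((HomologicalComplex.homologyFunctor M (ComplexShape.down ℕ) n).map
      ((S.mapHomologicalComplex (ComplexShape.down ℕ)).map θ ≫
        (NatTrans.mapHomologicalComplex α (ComplexShape.down ℕ)).app Q.complex)) := by
    rw [hκ, Functor.map_comp]
    exact IsIso.comp_isIso' inferInstance this
  exact IsIso.comp_isIso' inferInstance (IsIso.comp_isIso' hiso inferInstance)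

end DerivedComparison

/-! ### The isomorphism of torsion groups. -/

section Main

variable {T : Type u} [SmallCategory T] {W : MorphismProperty (SCat T)} [W.IsMultiplicative]
  {k : Type u} [CommRing k] {F : Tᵒᵖ ⥤ ModuleCat.{u} k}
  [HasFiniteCoproducts T] [HasZeroMorphisms T]

/-- The comparison morphism of torsion groups is an isomorphism on analytic functors. -/
theorem isIso_torComparison (hW : SCat.canonical T ≤ W) (hs : SCat.IsStable W)
    (hF : IsAnalytic F) (G : T ⥤ ModuleCat.{u} k) (n : ℕ) :
    IsIso (torComparison (restrictedToOp W) F G n) :=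
  isIso_derivedComparison (E := pullback k (restrictedToOp W)) (L := (restrictedToOp W).lan)
    ((restrictedToOp W).lanAdjunction (ModuleCat.{u} k)) _ _ _
    (fun Y => by
      rw [Functor.lanAdjunction_unit]
      exact isIso_tensorLan G (restrictedToOp W) Y) n F
    (isResolution_lan_of_isAnalytic hW hs hF _)

end Main

/-! ### Canonical morphisms: translations, and graphs in the presence of a group structure. -/

namespace SCat

variable {T : Type u} [SmallCategory T] [HasFiniteCoproducts T] [HasZeroMorphisms T]

lemma canonical_translate {a a' : SCat T} (f : a ⟶ a') (b : T) (hf : canonical T f) :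
    canonical T (translate f b) := by
  obtain ⟨a⟩ := a
  obtain ⟨a'⟩ := a'
  obtain ⟨i, r, _⟩ := f
  obtain ⟨t, e, h₁, h₂⟩ := hf
  change i ≫ e.hom = coprod.inl at h₁
  change e.hom ≫ coprod.desc (𝟙 a) 0 = r at h₂
  -- Translating by `b` puts `b` after the complement `t`; exchanging the two makes `t` a complement
  -- of `a ⨿ b`.
  let s : (a ⨿ t) ⨿ b ≅ (a ⨿ b) ⨿ t :=
    { hom := coprod.desc (coprod.map coprod.inl (𝟙 t)) (coprod.inr ≫ coprod.inl)
      inv := coprod.desc (coprod.map coprod.inl (𝟙 b)) (coprod.inr ≫ coprod.inl)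
      hom_inv_id := by
        refine coprod.hom_ext (coprod.hom_ext ?_ ?_) ?_ <;>
          simp [coprod.inl_desc, coprod.inr_desc]
      inv_hom_id := by
        refine coprod.hom_ext (coprod.hom_ext ?_ ?_) ?_ <;>
          simp [coprod.inl_desc, coprod.inr_desc] }
  refine ⟨t, coprod.mapIso e (Iso.refl b) ≪≫ s, ?_, ?_⟩
  · change coprod.map i (𝟙 b) ≫ coprod.map e.hom (𝟙 b) ≫ s.hom = coprod.inl
    rw [coprod.map_map_assoc, h₁]
    refine coprod.hom_ext ?_ ?_ <;> simp [s, coprod.inl_desc, coprod.inr_desc]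
  · change (coprod.map e.hom (𝟙 b) ≫ s.hom) ≫ coprod.desc (𝟙 (a ⨿ b)) 0 = coprod.map r (𝟙 b)
    have h : s.hom ≫ coprod.desc (𝟙 (a ⨿ b)) 0 = coprod.map (coprod.desc (𝟙 a) 0) (𝟙 b) := by
      refine coprod.hom_ext (coprod.hom_ext ?_ ?_) ?_ <;>
        simp [s, coprod.inl_desc, coprod.inr_desc]
    rw [Category.assoc, h, coprod.map_map, h₂, Category.id_comp]

/-- If the morphisms with a given source form a group, in which zero is neutral and with which
composition on the right is compatible, then the morphisms `graph ψ` are canonical. -/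
lemma canonical_graph {g a : T} [∀ z : T, Group (g ⟶ z)]
    (hmul : ∀ {z w : T} (p q : g ⟶ z) (f : z ⟶ w), (p * q) ≫ f = (p ≫ f) * (q ≫ f))
    (hone : ∀ z : T, (0 : g ⟶ z) = 1) (ψ : g ⟶ a) : canonical T (graph ψ) := by
  have hinv {z w : T} (p : g ⟶ z) (f : z ⟶ w) : p⁻¹ ≫ f = (p ≫ f)⁻¹ := by
    rw [eq_inv_iff_mul_eq_one, ← hmul, inv_mul_cancel, ← hone, ← hone, zero_comp]
  -- A shear: `g` is embedded by its inclusion multiplied on the left by `ψ`, so that projecting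
  -- away the factor `g` leaves `ψ`. Multiplying by the inverse of `ψ` undoes it.
  let e : g ⨿ a ≅ a ⨿ g :=
    { hom := coprod.desc ((ψ ≫ coprod.inl) * coprod.inr) coprod.inl
      inv := coprod.desc coprod.inr ((ψ ≫ coprod.inr)⁻¹ * coprod.inl)
      hom_inv_id := by
        refine coprod.hom_ext ?_ ?_ <;>
          simp [coprod.inl_desc, coprod.inr_desc, hmul, mul_inv_cancel_left]
      inv_hom_id := by
        refine coprod.hom_ext ?_ ?_ <;>
          simp [coprod.inl_desc, coprod.inr_desc, hmul, hinv, inv_mul_cancel_left] }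
  refine ⟨g, e, coprod.inr_desc _ _, ?_⟩
  change e.hom ≫ coprod.desc (𝟙 a) 0 = coprod.desc ψ (𝟙 a)
  refine coprod.hom_ext ?_ ?_ <;> simp [e, coprod.inl_desc, coprod.inr_desc, hmul, hone]

lemma isCanonicalEpi_of_canonical {a b : SCat T} (f : a ⟶ b) (hf : canonical T f) :
    IsCanonicalEpi (r f) := by
  obtain ⟨t, e, -, h⟩ := hf
  exact ⟨a.obj, t, ⟨Arrow.isoMk e (Iso.refl _) (h.trans (Category.comp_id _).symm)⟩⟩

end SCat

/-! ### Free groups of finite rank. -/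

namespace Gr

/-- A morphism of `gr`, as a morphism of groups. -/
def toMonoidHom {x y : Gr.{u}} (f : x ⟶ y) :
    FreeGroup (ULift.{u} (Fin x.rank)) →* FreeGroup (ULift.{u} (Fin y.rank)) :=
  (InducedCategory.Hom.hom f).hom

/-- The morphism of `gr` with given values on the generators. -/
def lift {x y : Gr.{u}} (v : Fin x.rank → FreeGroup (ULift.{u} (Fin y.rank))) : x ⟶ y :=
  InducedCategory.homMk (GrpCat.ofHom (FreeGroup.lift fun i => v i.down))

/-- The value of a morphism of `gr` on a generator. -/
def val {x y : Gr.{u}} (f : x ⟶ y) (i : Fin x.rank) : FreeGroup (ULift.{u} (Fin y.rank)) :=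
  toMonoidHom f (FreeGroup.of ⟨i⟩)

lemma val_comp {x y z : Gr.{u}} (f : x ⟶ y) (g : y ⟶ z) (i : Fin x.rank) :
    val (f ≫ g) i = toMonoidHom g (val f i) := rfl

lemma val_lift {x y : Gr.{u}} (v : Fin x.rank → FreeGroup (ULift.{u} (Fin y.rank))) :
    val (lift v) = v :=
  funext fun _ => FreeGroup.lift_apply_of

lemma val_injective {x y : Gr.{u}} : Function.Injective (val : (x ⟶ y) → _) := fun f g h =>
  InducedCategory.hom_ext (GrpCat.hom_ext (FreeGroup.ext_hom (toMonoidHom f) (toMonoidHom g)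
    fun i => congrFun h i.down))

/-- Morphisms of `gr` correspond to families of elements. -/
def homEquiv (x y : Gr.{u}) : (x ⟶ y) ≃ (Fin x.rank → FreeGroup (ULift.{u} (Fin y.rank))) where
  toFun := val
  invFun := lift
  left_inv f := val_injective (val_lift (val f))
  right_inv := val_lift

/-- The pointwise product on generators of morphisms of `gr`. -/
instance homGroup (x y : Gr.{u}) : Group (x ⟶ y) := (homEquiv x y).group

lemma val_mul {x y : Gr.{u}} (f g : x ⟶ y) : val (f * g) = val f * val g :=
  (homEquiv x y).apply_symm_apply _

lemma val_one {x y : Gr.{u}} : val (1 : x ⟶ y) = 1 :=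
  (homEquiv x y).apply_symm_apply 1

lemma mul_comp {x y z : Gr.{u}} (f g : x ⟶ y) (h : y ⟶ z) : (f * g) ≫ h = (f ≫ h) * (g ≫ h) :=
  val_injective <| by
    rw [val_mul]
    funext i
    rw [val_comp, val_mul]
    exact map_mul _ _ _

lemma one_comp {x y z : Gr.{u}} (h : y ⟶ z) : (1 : x ⟶ y) ≫ h = 1 :=
  val_injective <| by
    rw [val_one]
    funext i
    rw [val_comp, val_one]
    exact map_one _

lemma toMonoidHom_one {x y : Gr.{u}} : toMonoidHom (1 : x ⟶ y) = 1 :=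
  FreeGroup.ext_hom _ _ fun i => congrFun val_one i.down

/-- The zero morphism is by definition the unit of `homGroup`, as `SCat.canonical_graph` requires.
-/
instance hasZeroMorphisms : HasZeroMorphisms Gr.{u} where
  zero _ _ := ⟨1⟩
  comp_zero f z := val_injective <| by
    funext i
    rw [val_comp]
    exact (DFunLike.congr_fun toMonoidHom_one _).trans (congrFun val_one i).symm
  zero_comp _ _ _ f := one_comp f

instance hasZeroObject : HasZeroObject Gr.{u} where
  zero := ⟨⟨0⟩, (IsZero.iff_id_eq_zero _).2 (val_injective (funext fun i => i.elim0))⟩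

/-- The left inclusion in a free product. -/
def inl (x y : Gr.{u}) : x ⟶ Gr.mk (x.rank + y.rank) :=
  lift fun i => FreeGroup.of ⟨Fin.castAdd y.rank i⟩

/-- The right inclusion in a free product. -/
def inr (x y : Gr.{u}) : y ⟶ Gr.mk (x.rank + y.rank) :=
  lift fun i => FreeGroup.of ⟨Fin.natAdd x.rank i⟩

lemma val_inl_comp {x y z : Gr.{u}} (f : Gr.mk (x.rank + y.rank) ⟶ z) (i : Fin x.rank) :
    val (inl x y ≫ f) i = val f (Fin.castAdd y.rank i) := by
  rw [val_comp, inl, val_lift]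
  rfl

lemma val_inr_comp {x y z : Gr.{u}} (f : Gr.mk (x.rank + y.rank) ⟶ z) (i : Fin y.rank) :
    val (inr x y ≫ f) i = val f (Fin.natAdd x.rank i) := by
  rw [val_comp, inr, val_lift]
  rfl

/-- The morphism from a free product with given components. -/
def desc {x y z : Gr.{u}} (f : x ⟶ z) (g : y ⟶ z) : Gr.mk (x.rank + y.rank) ⟶ z :=
  lift (Fin.addCases (val f) (val g))

lemma inl_desc {x y z : Gr.{u}} (f : x ⟶ z) (g : y ⟶ z) : inl x y ≫ desc f g = f :=
  val_injective <| funext fun i => by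
    rw [val_inl_comp, desc, val_lift, Fin.addCases_left]

lemma inr_desc {x y z : Gr.{u}} (f : x ⟶ z) (g : y ⟶ z) : inr x y ≫ desc f g = g :=
  val_injective <| funext fun i => by
    rw [val_inr_comp, desc, val_lift, Fin.addCases_right]

lemma desc_ext {x y z : Gr.{u}} {f g : Gr.mk (x.rank + y.rank) ⟶ z}
    (h₁ : inl x y ≫ f = inl x y ≫ g) (h₂ : inr x y ≫ f = inr x y ≫ g) : f = g :=
  val_injective <| funext fun i => by
    induction i using Fin.addCases with
    | left i => rw [← val_inl_comp, h₁, val_inl_comp]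
    | right i => rw [← val_inr_comp, h₂, val_inr_comp]

/-- The free group of rank `m + n` is the coproduct of the free groups of ranks `m` and `n`. -/
def isColimitCofan (x y : Gr.{u}) : IsColimit (BinaryCofan.mk (inl x y) (inr x y)) :=
  BinaryCofan.IsColimit.mk _ desc inl_desc inr_desc fun f g _ hf hg =>
    desc_ext (hf.trans (inl_desc f g).symm) (hg.trans (inr_desc f g).symm)

instance hasFiniteCoproducts : HasFiniteCoproducts Gr.{u} :=
  have : ∀ {x y : Gr.{u}}, HasColimit (pair x y) := fun {x y} => ⟨⟨⟨_, isColimitCofan x y⟩⟩⟩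
  have := hasBinaryCoproducts_of_hasColimit_pair Gr.{u}
  have : HasInitial Gr.{u} := HasZeroObject.hasInitial
  hasFiniteCoproducts_of_has_binary_and_initial

/-- Freeness of `g` makes the pointwise product on generators a group law on morphisms out of `g`,
and composing with a group morphism afterwards respects it. -/
lemma canonical_graph {g a : Gr.{u}} (ψ : g ⟶ a) : SCat.canonical Gr.{u} (SCat.graph ψ) :=
  SCat.canonical_graph mul_comp (fun _ => rfl) ψ

lemma isStable_canonical : SCat.IsStable (SCat.canonical Gr.{u}) where
  translate f b hf := SCat.canonical_translate f b hf
  graph ψ := canonical_graph ψ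

/-- The folding map is the retraction part of the graph of the identity, which is canonical. -/
lemma propertyH : PropertyH Gr.{u} := fun a =>
  SCat.isCanonicalEpi_of_canonical _ (canonical_graph (𝟙 a))

end Gr

end FunctorHomology

theorem mainTheorem4 :
    (∀ (k : Type u) [CommRing k]
      (T : Type u) [SmallCategory T] [HasZeroObject T] [HasZeroMorphisms T]
      [HasFiniteCoproducts T] (_ : FunctorHomology.PropertyH T)
      (W : MorphismProperty (FunctorHomology.SCat T)) [W.IsMultiplicative]
      (_ : FunctorHomology.SCat.canonical T ≤ W)
      (_ : FunctorHomology.SCat.IsStable W)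
      (F : Tᵒᵖ ⥤ ModuleCat.{u} k) (_ : FunctorHomology.IsAnalytic F)
      (G : T ⥤ ModuleCat.{u} k) (n : ℕ),
      IsIso (FunctorHomology.torComparison (FunctorHomology.restrictedToOp W) F G n)) ∧
    (∃ (_ : HasZeroObject FunctorHomology.Gr.{u}) (_ : HasZeroMorphisms FunctorHomology.Gr.{u})
      (_ : HasFiniteCoproducts FunctorHomology.Gr.{u}),
      FunctorHomology.PropertyH FunctorHomology.Gr.{u} ∧
      FunctorHomology.SCat.IsStable (FunctorHomology.SCat.canonical FunctorHomology.Gr.{u})) := by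
  refine ⟨?_, FunctorHomology.Gr.hasZeroObject, FunctorHomology.Gr.hasZeroMorphisms,
    FunctorHomology.Gr.hasFiniteCoproducts, FunctorHomology.Gr.propertyH,
    FunctorHomology.Gr.isStable_canonical⟩
  intro k _ T _ _ _ _ _ W _ hW hs F hF G n
  exact FunctorHomology.isIso_torComparison hW hs hF G n
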